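/- Let $(X_j)_{j\ge 1}$ be a (strictly) stationary sequence of real random variables, let $F(x)=\mathbb P(X_1\le x)$ be its marginal distribution function, and let $M_n=\max_{1\le j\le n}X_j$. For $s\in\mathbb N=\{1,2,\dots\}$ let $\mathcal M^s$ be the set of all measurable non-constant functions $f:\mathbb R^s\to\mathbb R$ with $\sup|f|\le 1$, and for $f\in\mathcal M^s$ let $$\operatorname{Lip} f=\sup_{y\ne x}\frac{|f(y)-f(x)|}{|y_1-x_1|+\cdots+|y_s-x_s|}\in(0,\infty].$$ For $r\in\mathbb N$ let $$\eta(r)=\sup\frac{\bigl|\operatorname{Cov}\bigl(f(X_{i_1},\dots,X_{i_s}),\,g(X_{j_1},\dots,X_{j_t})\bigr)\bigr|}{s\operatorname{Lip} f+t\operatorname{Lip} g}\in[0,\infty],$$ where the supremum is over all $s,t\in\mathbb N$, $f\in\mathcal M^s$, $g\in\mathcal M^t$ and all indices $i_1\le\cdots\le i_s\le j_1\le\cdots\le j_t$ with $j_1-i_s\ge r$ (a quotient with infinite denominator is $0$). The sequence is called $\eta$-weakly dependent if $\eta(r)\to0$ as $r\to\infty$. **Theorem.** Suppose that $F$ is continuous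 and satisfies the concentration assumption with some exponent $b>0$: there is a constant $B>0$ such that $$F(x+u)-F(x)\le B\,u^{b}\qquad\text{for all } x\in\mathbb R,\ u>0.$$ Suppose further that $(X_j)$ is $\eta$-weakly dependent and that $\eta(r)=O(r^{-\beta})$ as $r\to\infty$ for some $\beta>2\left(1+\frac1b\right)$. Then $(X_j)$ admits a continuous phantom distribution function, i.e. there is a continuous distribution function $G$ on $\mathbb R$ such that $$\mathbb P(M_n\le u_n)-G(u_n)^n\longrightarrow 0\quad (n\to\infty)\qquad\text{for every real sequence }(u_n),$$ equivalently $\sup_{u\in\mathbb R}\bigl|\mathbb P(M_n\le u)-G(u)^n\bigr|\to0$. -/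

import Mathlib

open MeasureTheory ProbabilityTheory Filter
open scoped Topology ENNReal

namespace PhantomDF

noncomputable section

/-! Sequences are indexed from `0`: the term `X j` is the `(j+1)`-st term of the sequence
`X₁, X₂, …` of the usual notation. -/

/-- Strict stationarity: for every `k`, the shifted sequence `(X_{j+k})_j` has the same law
(on the product space) as `(X_j)_j`. -/
def IsStationary {Ω : Type*} [MeasurableSpace Ω] (X : ℕ → Ω → ℝ) (μ : Measure Ω) : Prop :=
  ∀ k : ℕ, IdentDistrib (fun ω (j : ℕ) => X (j + k) ω) (fun ω (j : ℕ) => X j ω) μ μ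

/-- The marginal distribution function `F(x) = P(X₁ ≤ x)` (the first term is `X 0`). -/
def marginalDF {Ω : Type*} [MeasurableSpace Ω] (X : ℕ → Ω → ℝ) (μ : Measure Ω) : ℝ → ℝ :=
  fun x => cdf (μ.map (X 0)) x

/-- The maximum `M_n` of the first `n` terms of the sequence (with the irrelevant value `0` for
`n = 0`). -/
def partialMax {Ω : Type*} (X : ℕ → Ω → ℝ) (n : ℕ) (ω : Ω) : ℝ :=
  ⨆ j : Fin n, X j ω

/-- `G` is a distribution function on the real line: the distribution function of some
probability measure. -/
def IsDistributionFunction (G : ℝ → ℝ) : Prop :=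
  ∃ ν : Measure ℝ, IsProbabilityMeasure ν ∧ ∀ x, G x = cdf ν x

/-- `G` is a phantom distribution function for `X`: it is a distribution function and
`P(M_n ≤ u_n) - G(u_n)^n → 0` for every real sequence `(u_n)`. -/
def IsPhantomDF {Ω : Type*} [MeasurableSpace Ω] (X : ℕ → Ω → ℝ) (μ : Measure Ω)
    (G : ℝ → ℝ) : Prop :=
  IsDistributionFunction G ∧
    ∀ u : ℕ → ℝ,
      Tendsto (fun n : ℕ => μ.real {ω | partialMax X n ω ≤ u n} - G (u n) ^ n) atTop (𝓝 0)

/-- The sequence admits a continuous phantom distribution function. -/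
def AdmitsContinuousPhantomDF {Ω : Type*} [MeasurableSpace Ω] (X : ℕ → Ω → ℝ)
    (μ : Measure Ω) : Prop :=
  ∃ G : ℝ → ℝ, Continuous G ∧ IsPhantomDF X μ G

/-- The concentration assumption with exponent `b` on a distribution function `F`. -/
def Concentration (F : ℝ → ℝ) (b : ℝ) : Prop :=
  ∃ B : ℝ, 0 < B ∧ ∀ x u : ℝ, 0 < u → F (x + u) - F x ≤ B * u ^ b

/-- The class of measurable non-constant functions on `ℝ^s` with absolute value at most `1`.
(It is empty for `s = 0`.) -/
structure IsTestFunction {s : ℕ} (f : (Fin s → ℝ) → ℝ) : Prop where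
  measurable : Measurable f
  abs_le_one : ∀ x, |f x| ≤ 1
  nonconstant : ∃ x y, f x ≠ f y

/-- The Lipschitz coefficient (possibly infinite) with respect to the `ℓ¹` distance
`|y₁ - x₁| + ⋯ + |y_s - x_s|`. -/
def lipCoeff {s : ℕ} (f : (Fin s → ℝ) → ℝ) : ℝ≥0∞ :=
  ⨆ (x : Fin s → ℝ) (y : Fin s → ℝ) (_ : y ≠ x),
    ENNReal.ofReal (|f y - f x| / ∑ a, |y a - x a|)

/-- The `η`-dependence coefficient `η(r)`, with values in `[0, ∞]`: the supremum of
`|Cov(f(X_{i_1}, …, X_{i_s}), g(X_{j_1}, …, X_{j_t}))| / (s Lip f + t Lip g)`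
over all test functions `f`, `g` on `ℝ^s`, `ℝ^t` and all indices
`i_1 ≤ ⋯ ≤ i_s ≤ j_1 ≤ ⋯ ≤ j_t` with `j_1 - i_s ≥ r`. The quotient is `0` if `f` or `g` is not
Lipschitz; the denominator is never `0` since `f` and `g` are not constant. -/
def etaCoeff {Ω : Type*} [MeasurableSpace Ω] (X : ℕ → Ω → ℝ) (μ : Measure Ω)
    (r : ℕ) : ℝ≥0∞ :=
  ⨆ (s : ℕ) (t : ℕ) (f : (Fin s → ℝ) → ℝ) (g : (Fin t → ℝ) → ℝ)
    (_ : IsTestFunction f) (_ : IsTestFunction g)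
    (i : Fin s → ℕ) (j : Fin t → ℕ) (_ : Monotone i) (_ : Monotone j)
    (_ : ∀ a c, i a + r ≤ j c),
    ENNReal.ofReal |cov[fun ω => f (fun a => X (i a) ω), fun ω => g (fun c => X (j c) ω); μ]| /
      ((s : ℝ≥0∞) * lipCoeff f + (t : ℝ≥0∞) * lipCoeff g)

/-- `η`-weak dependence: `η(r) → 0` as `r → ∞`. -/
def IsEtaWeaklyDependent {Ω : Type*} [MeasurableSpace Ω] (X : ℕ → Ω → ℝ)
    (μ : Measure Ω) : Prop :=
  Tendsto (etaCoeff X μ) atTop (𝓝 0)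

end

end PhantomDF

namespace PhantomDF

/-! Write `a n = P(M_n ≤ u)`, with `u` fixed. Replacing indicators by Lipschitz ramps of width
`r^(-β/(1+b))` turns η-dependence and concentration into asymptotic independence of the events `{X_j
≤ u, j ∈ S}` and `{X_j ≤ u, j ∈ T}` for sets at distance `r`, with error of order `(|S| + |T|)
r^(-θ)`, `θ = βb/(1+b)` (`exists_abs_probLE_union_sub_le`). The threshold on `β` says exactly that
`θ > 2`.

Cutting out gaps of length `r` makes `a` nearly multiplicative at cost `r (1 - F u)`. If `a m ≥
1/e`, then sampling about `m / r` well-spaced variables bounds `1 - F u` by a multiple of `r / m`.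
Hence `r ≈ m^α` with `α < 1/2` makes this cost small, and `θ > 2` leaves room for the mixing errors
(`exists_gap_and_blocks`, `exists_forall_mixing`). A monotone, nearly multiplicative sequence with
small steps that crosses `1/e` at time `m` is uniformly close to `exp (-n / m)`
(`exists_forall_abs_sub_exp_le`).

So `G u` must be close to `exp (-1 / m)`, where the crossing time `m` depends on `u`. That value
itself jumps with `u`. It is smoothed by taking the supremum over `n` of `phantomTerm n (a n)`: the
term `n = m` gives at least `exp (-1 / m)`, the others exceed it only slightly (`mul_min_le`), and
terms with `a n ≤ 1/(2e)` vanish, so that the supremum is locally finite, hence continuous, where `F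
< 1`. Levels `u` with a bounded crossing time are handled by monotonicity: both `P(M_n ≤ u)` and
`G(u)^n` are then eventually small, uniformly in `u`. -/

/-! ### Nearly multiplicative sequences and exponentials. -/

lemma exp_neg_sub_exp_neg_le {s t : ℝ} (hs : 0 ≤ s) :
    Real.exp (-s) - Real.exp (-t) ≤ |s - t| := by
  have h1 : Real.exp (-t) = Real.exp (-s) * Real.exp (s - t) := by
    rw [← Real.exp_add]; ring_nf
  have h2 := Real.add_one_le_exp (s - t)
  have h3 : Real.exp (-s) ≤ 1 := by simpa using hs
  have h4 := Real.exp_pos (-s)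
  have h5 := neg_abs_le (s - t)
  have h6 := abs_nonneg (s - t)
  rw [h1]
  nlinarith

/-- An approximately multiplicative sequence is close to the powers of its first relevant term. -/
lemma abs_mul_sub_pow_le {a : ℕ → ℝ} {ε : ℝ} {p N : ℕ} (h0 : a 0 = 1)
    (hp : |a p| ≤ 1) (hmul : ∀ i j, i + j ≤ N → |a (i + j) - a i * a j| ≤ ε) (j : ℕ)
    (hj : j * p ≤ N) : |a (j * p) - a p ^ j| ≤ j * ε := by
  induction j with
  | zero => simp [h0]
  | succ j ih =>
    have h1 : j * p + p ≤ N := by rw [← Nat.succ_mul]; exact hj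
    have h2 := ih (by omega)
    have h3 := hmul _ _ h1
    have h4 : |a (j * p) * a p - a p ^ j * a p| ≤ j * ε := by
      rw [← sub_mul, abs_mul]
      calc _ ≤ |a (j * p) - a p ^ j| * 1 := by gcongr
        _ ≤ _ := by linarith
    rw [Nat.succ_mul, pow_succ]
    push_cast
    calc _ ≤ |a (j * p + p) - a (j * p) * a p| + |a (j * p) * a p - a p ^ j * a p| :=
          abs_sub_le _ _ _
      _ ≤ _ := by linarith

lemma abs_pow_sub_pow_le {x y : ℝ} (hx : |x| ≤ 1) (hy : |y| ≤ 1) (j : ℕ) :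
    |x ^ j - y ^ j| ≤ j * |x - y| := by
  induction j with
  | zero => simp
  | succ j ih =>
    have h1 : x ^ (j + 1) - y ^ (j + 1) = x ^ j * (x - y) + (x ^ j - y ^ j) * y := by ring
    rw [h1]
    push_cast
    calc _ ≤ |x ^ j * (x - y)| + |(x ^ j - y ^ j) * y| := abs_add_le _ _
      _ = |x| ^ j * |x - y| + |x ^ j - y ^ j| * |y| := by rw [abs_mul, abs_mul, abs_pow]
      _ ≤ 1 * |x - y| + (j * |x - y|) * 1 := by
          gcongr
          exact pow_le_one₀ (abs_nonneg _) hx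
      _ = _ := by ring

lemma pow_mul_abs_sub_le_abs_pow_sub_pow {x y : ℝ} (hx : 0 ≤ x) (hy : 0 ≤ y) (j : ℕ) :
    y ^ j * |x - y| ≤ |x ^ (j + 1) - y ^ (j + 1)| := by
  rw [← (Commute.all x y).geom_sum₂_mul (j + 1), abs_mul]
  gcongr
  refine le_trans ?_ (le_abs_self _)
  have := Finset.single_le_sum (f := fun i => x ^ i * y ^ (j + 1 - 1 - i))
    (s := Finset.range (j + 1)) (fun i _ => by positivity) (a := 0) (by simp)
  simpa using this

/-- Extracting the `L`-th root loses only a constant, uniformly in `L`, because the single term `y ^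
(L - 1) ≥ 1/e ≥ 1/3` of the geometric sum already suffices. -/
lemma abs_sub_le_of_pow_eq_exp_neg_one {x y : ℝ} {L : ℕ} (hL : 1 ≤ L) (hx : 0 ≤ x) (hy0 : 0 ≤ y)
    (hy1 : y ≤ 1) (hyL : y ^ L = Real.exp (-1)) : |x - y| ≤ 3 * |x ^ L - y ^ L| := by
  have hexp3 : (1 / 3 : ℝ) ≤ Real.exp (-1) := by
    rw [Real.exp_neg, ← one_div]
    exact one_div_le_one_div_of_le (Real.exp_pos 1) (by linarith [Real.exp_one_lt_d9])
  obtain ⟨l, rfl⟩ : ∃ l, L = l + 1 := ⟨L - 1, by omega⟩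
  have h1 := pow_mul_abs_sub_le_abs_pow_sub_pow hx hy0 l
  have h2 : (1 / 3 : ℝ) ≤ y ^ l := by
    refine (hexp3.trans hyL.ge).trans ?_
    exact pow_le_pow_of_le_one hy0 hy1 (Nat.le_succ l)
  have h3 : 1 / 3 * |x - y| ≤ y ^ l * |x - y| := by gcongr
  linarith

lemma div_mem_Icc_of_block {L T m n p j : ℕ} (hL : 1 ≤ L) (hp0 : 0 < p) (hm0 : 0 < m)
    (hLp : L * p ≤ m) (hmp : m < (L + 1) * p) (hjn : j * p ≤ n) (hnj : n < (j + 1) * p)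
    (hjTR : (j : ℝ) ≤ T * (L + 1)) :
    (n / m : ℝ) ≤ (j + 1) / L ∧ (j / L : ℝ) - T / L ≤ n / m := by
  have hLR : (1 : ℝ) ≤ L := by exact_mod_cast hL
  have hmR : (0 : ℝ) < m := by exact_mod_cast hm0
  have hpR : (0 : ℝ) < p := by exact_mod_cast hp0
  have hup : (n / m : ℝ) ≤ (j + 1) / L := by
    rw [div_le_div_iff₀ hmR (by positivity)]
    have e1 : (n : ℝ) ≤ (j + 1) * p := by exact_mod_cast hnj.le
    have e2 : (L : ℝ) * p ≤ m := by exact_mod_cast hLp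
    calc (n : ℝ) * L ≤ (j + 1) * p * L := by gcongr
      _ = (j + 1) * (L * p) := by ring
      _ ≤ _ := by gcongr
  have hlow : (j / L : ℝ) - T / L ≤ n / m := by
    have e1 : (j : ℝ) * p ≤ n := by exact_mod_cast hjn
    have e2 : (m : ℝ) ≤ (L + 1) * p := by exact_mod_cast hmp.le
    have e3 : (j : ℝ) / (L + 1) ≤ n / m := by
      rw [div_le_div_iff₀ (by positivity) hmR]
      calc (j : ℝ) * m ≤ j * ((L + 1) * p) := by gcongr
        _ = j * p * (L + 1) := by ring
        _ ≤ _ := by gcongr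
    refine le_trans ?_ e3
    rw [← sub_div, div_le_div_iff₀ (by positivity) (by positivity)]
    nlinarith
  exact ⟨hup, hlow⟩

/-- A nonincreasing, approximately multiplicative sequence with small steps which crosses the
level `1 / e` at time `m` is close to `exp (- n / m)`, as long as `n ≤ T * m`. -/
lemma abs_sub_exp_le_of_le {a : ℕ → ℝ} {ε : ℝ} {L T m n : ℕ} (ha : Antitone a)
    (h0 : a 0 = 1) (hnn : ∀ n, 0 ≤ a n) (hL : 1 ≤ L) (hT : 1 ≤ T) (hm : L * L ≤ m) (hε : 0 ≤ ε)
    (hstep : ∀ n k, a n - a (n + k) ≤ k * ε) (hm1 : Real.exp (-1) ≤ a m)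
    (hm2 : a (m + 1) < Real.exp (-1))
    (hmul : ∀ p q, p + q ≤ (T + 1) * m → |a (p + q) - a p * a q| ≤ ε) (hn : n ≤ T * m) :
    |a n - Real.exp (-(n / m : ℝ))| ≤ 30 * T * L ^ 2 * ε + (T + 1) / L := by
  have hle1 : ∀ n, a n ≤ 1 := fun n => h0 ▸ ha (Nat.zero_le n)
  have habs : ∀ n, |a n| ≤ 1 := fun n => by rw [abs_of_nonneg (hnn n)]; exact hle1 n
  -- Blocks of length `p`, about `L` of them up to time `m`. The assumption `L * L ≤ m` gives `L ≤
  -- p`, so the remainder of `m` modulo `L` is shorter than one block.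
  obtain ⟨p, hp⟩ : ∃ p, p = m / L := ⟨_, rfl⟩
  have hpL : L ≤ p := by rw [hp]; exact (Nat.le_div_iff_mul_le hL).2 hm
  have hp0 : 0 < p := by omega
  have hLp : L * p ≤ m := by rw [hp]; exact Nat.mul_div_le m L
  have hmp : m < (L + 1) * p := by
    have : m < L * (p + 1) := by rw [hp]; exact Nat.lt_mul_div_succ m hL
    nlinarith
  have hmLp : m + 1 ≤ L * p + L := by
    have : m < L * (p + 1) := by rw [hp]; exact Nat.lt_mul_div_succ m hL
    linarith
  have hm0 : 0 < m := by nlinarith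
  have hLR : (1 : ℝ) ≤ L := by exact_mod_cast hL
  have hTR : (1 : ℝ) ≤ T := by exact_mod_cast hT
  have hmR : (0 : ℝ) < m := by exact_mod_cast hm0
  have hpR : (0 : ℝ) < p := by exact_mod_cast hp0
  set x := a p with hx
  obtain ⟨y, hy⟩ : ∃ y, y = Real.exp (-(1 / L : ℝ)) := ⟨_, rfl⟩
  have hy0 : 0 < y := hy ▸ Real.exp_pos _
  have hy1 : y ≤ 1 := by rw [hy]; simp
  have hyj : ∀ j : ℕ, y ^ j = Real.exp (-(j / L : ℝ)) := fun j => by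
    rw [hy, ← Real.exp_nat_mul]; congr 1; ring
  have hyL : y ^ L = Real.exp (-1) := by
    rw [hyj, div_self (by positivity)]
  have hxL : |x ^ L - y ^ L| ≤ 2 * L * ε := by
    have h1 := abs_mul_sub_pow_le h0 (habs p) hmul L (by nlinarith)
    have h2 : Real.exp (-1) ≤ a (L * p) := hm1.trans (ha hLp)
    -- Since `m + 1` exceeds `L * p` by at most `L`, small steps pin `a (L * p)` to the level `1/e`
    -- from above as well.
    have h3 : a (L * p) ≤ a (m + 1) + L * ε := by
      have := hstep (L * p) L
      have := ha hmLp
      linarith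
    rw [hyL]
    rw [abs_le] at h1 ⊢
    constructor <;> linarith
  have hxy : |x - y| ≤ 6 * L * ε := by
    have := abs_sub_le_of_pow_eq_exp_neg_one hL (hnn p) hy0.le hy1 hyL
    linarith
  have hkey : ∀ j : ℕ, j * p ≤ (T + 1) * m → |a (j * p) - y ^ j| ≤ j * (7 * L * ε) := by
    intro j hj
    have h1 := abs_mul_sub_pow_le h0 (habs p) hmul j hj
    have h2 := abs_pow_sub_pow_le (habs p) (by rwa [abs_of_pos hy0] : |y| ≤ 1) j
    calc _ ≤ |a (j * p) - x ^ j| + |x ^ j - y ^ j| := abs_sub_le _ _ _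
      _ ≤ j * ε + j * (6 * L * ε) := by
          refine add_le_add h1 (h2.trans ?_)
          gcongr
      _ ≤ _ := by
          have : (j : ℝ) * ε ≤ j * (L * ε) := by
            gcongr; nlinarith
          linarith
  obtain ⟨j, hj⟩ : ∃ j, j = n / p := ⟨_, rfl⟩
  have hjn : j * p ≤ n := by rw [hj]; exact Nat.div_mul_le_self n p
  have hnj : n < (j + 1) * p := by
    rw [hj, mul_comm]; exact Nat.lt_mul_div_succ n hp0
  have hjT : j ≤ T * (L + 1) := by
    have : j * p < T * (L + 1) * p := by nlinarith
    exact (lt_of_mul_lt_mul_right this (Nat.zero_le p)).le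
  have hjp1 : (j + 1) * p ≤ (T + 1) * m := by nlinarith
  have hjTR : (j : ℝ) ≤ T * (L + 1) := by exact_mod_cast hjT
  have hj1 := hkey j (by nlinarith)
  have hj2 := hkey (j + 1) hjp1
  have herr : ((j + 1 : ℕ) : ℝ) * (7 * L * ε) ≤ 30 * T * L ^ 2 * ε := by
    push_cast
    have : (j : ℝ) + 1 ≤ 3 * T * L := by nlinarith
    calc _ ≤ 3 * T * L * (7 * L * ε) := by gcongr
      _ = 21 * (T * L ^ 2 * ε) := by ring
      _ ≤ 30 * (T * L ^ 2 * ε) := by gcongr; norm_num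
      _ = _ := by ring
  have herr' : (j : ℝ) * (7 * L * ε) ≤ 30 * T * L ^ 2 * ε := by
    refine le_trans ?_ herr
    gcongr
    simp
  obtain ⟨hup, hlow⟩ := div_mem_Icc_of_block hL hp0 hm0 hLp hmp hjn hnj hjTR
  have hn0 : (0 : ℝ) ≤ n / m := by positivity
  rw [abs_le]
  constructor
  · have h1 : a ((j + 1) * p) ≤ a n := ha hnj.le
    have h2 : Real.exp (-(n / m : ℝ)) - y ^ (j + 1) ≤ (T + 1) / L := by
      rw [hyj]
      refine (exp_neg_sub_exp_neg_le hn0).trans ?_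
      push_cast
      rw [abs_le]
      simp only [add_div] at hup ⊢
      constructor <;> linarith
    have h3 := (abs_le.1 hj2).1
    linarith
  · have h1 : a n ≤ a (j * p) := ha hjn
    have h2 : y ^ j - Real.exp (-(n / m : ℝ)) ≤ (T + 1) / L := by
      rw [hyj]
      refine (exp_neg_sub_exp_neg_le (by positivity)).trans ?_
      have : (0 : ℝ) ≤ 1 / L := by positivity
      have : (0 : ℝ) ≤ T / L := by positivity
      rw [abs_le]
      simp only [add_div] at hup ⊢
      constructor <;> linarith
    have h3 := (abs_le.1 hj1).2
    linarith

lemma exists_forall_abs_sub_exp_le {ε : ℝ} (hε : 0 < ε) :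
    ∃ (T m₀ : ℕ) (δ : ℝ), 0 < δ ∧ ∀ (a : ℕ → ℝ) (m : ℕ), Antitone a → a 0 = 1 →
      (∀ n, 0 ≤ a n) → m₀ ≤ m → (∀ n k, a n - a (n + k) ≤ k * δ) → Real.exp (-1) ≤ a m →
      a (m + 1) < Real.exp (-1) →
      (∀ p q, p + q ≤ T * m → |a (p + q) - a p * a q| ≤ δ) →
      ∀ n : ℕ, |a n - Real.exp (-(n / m : ℝ))| ≤ ε := by
  -- `T` makes the tail `exp (-T)` at most `ε / 3`, then `L` makes the discretisation error `(T + 1)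
  -- / L` at most `ε / 3`, and `δ` does the same for `30 T L² δ`. Beyond `T * m` both quantities are
  -- small by monotonicity.
  obtain ⟨T, hT⟩ : ∃ T : ℕ, max 1 (3 / ε) ≤ T := exists_nat_ge _
  have hT1 : 1 ≤ T := by exact_mod_cast (le_max_left _ _).trans hT
  have hTε : 3 / ε ≤ T := (le_max_right _ _).trans hT
  have hTR : (1 : ℝ) ≤ T := by exact_mod_cast hT1
  obtain ⟨L, hL⟩ : ∃ L : ℕ, max 1 (3 * (T + 1) / ε) ≤ L := exists_nat_ge _
  have hL1 : 1 ≤ L := by exact_mod_cast (le_max_left _ _).trans hL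
  have hLε : 3 * (T + 1) / ε ≤ L := (le_max_right _ _).trans hL
  have hLR : (1 : ℝ) ≤ L := by exact_mod_cast hL1
  have hexpT : Real.exp (-(T : ℝ)) ≤ ε / 3 := by
    rw [Real.exp_neg, inv_le_comm₀ (Real.exp_pos _) (by positivity), inv_div]
    linarith [Real.add_one_le_exp (T : ℝ)]
  have hTL : (T + 1 : ℝ) / L ≤ ε / 3 := by
    rw [div_le_iff₀ hε] at hLε
    rw [div_le_iff₀ (by positivity)]
    linarith
  refine ⟨T + 1, L * L, ε / (90 * T * L ^ 2), by positivity, ?_⟩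
  intro a m ha h0 hnn hm hstep hm1 hm2 hmul
  have hmR : (0 : ℝ) < m := by exact_mod_cast (by nlinarith : 0 < m)
  have hbd : ∀ n ≤ T * m, |a n - Real.exp (-(n / m : ℝ))| ≤ 2 * (ε / 3) := by
    intro n hn
    have := abs_sub_exp_le_of_le ha h0 hnn hL1 hT1 hm (by positivity) hstep hm1 hm2 hmul hn
    have e : 30 * T * L ^ 2 * (ε / (90 * T * L ^ 2)) = ε / 3 := by field_simp; norm_num
    linarith
  intro n
  rcases le_total n (T * m) with hn | hn
  · linarith [hbd n hn]
  · have h1 := (abs_le.1 (hbd _ le_rfl)).2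
    have h2 : (((T * m : ℕ) : ℝ) / m) = T := by push_cast; field_simp
    rw [h2] at h1
    have h3 := ha hn
    have h4 : Real.exp (-(n / m : ℝ)) ≤ Real.exp (-(T : ℝ)) := by
      rw [Real.exp_le_exp, neg_le_neg_iff, le_div_iff₀ hmR]
      exact_mod_cast hn
    have h5 := Real.exp_pos (-(n / m : ℝ))
    rw [abs_le]
    constructor <;> linarith [hnn n]

/-! ### The supremum that recovers the crossing time. -/

/-- The `n`-th term of the supremum defining the phantom distribution function: a continuous nondecreasing function of
`x` which vanishes for `x ≤ 1 / (2 e)` and equals `exp (- 1 / n)` for `x ≥ 1 / e`. -/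
noncomputable def phantomTerm (n : ℕ) (x : ℝ) : ℝ :=
  expNegInvGlue (n * min 1 (2 * Real.exp 1 * x - 1))

lemma monotone_phantomTerm (n : ℕ) : Monotone (phantomTerm n) := fun x y h =>
  expNegInvGlue.monotone (by gcongr)

lemma continuous_phantomTerm (n : ℕ) : Continuous (phantomTerm n) :=
  (expNegInvGlue.contDiff (n := 0)).continuous.comp (by fun_prop)

lemma phantomTerm_nonneg (n : ℕ) (x : ℝ) : 0 ≤ phantomTerm n x := expNegInvGlue.nonneg _

lemma expNegInvGlue_of_pos {x : ℝ} (hx : 0 < x) : expNegInvGlue x = Real.exp (-x⁻¹) := by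
  simp [expNegInvGlue, not_le.2 hx]

lemma expNegInvGlue_lt_one (x : ℝ) : expNegInvGlue x < 1 := by
  rcases le_or_gt x 0 with h | h
  · rw [expNegInvGlue.zero_of_nonpos h]; norm_num
  · rw [expNegInvGlue_of_pos h]; simpa using h

lemma phantomTerm_lt_one (n : ℕ) (x : ℝ) : phantomTerm n x < 1 := expNegInvGlue_lt_one _

lemma phantomTerm_eq_zero {n : ℕ} {x : ℝ} (hx : 2 * Real.exp 1 * x ≤ 1) :
    phantomTerm n x = 0 :=
  expNegInvGlue.zero_of_nonpos
    (mul_nonpos_of_nonneg_of_nonpos (by positivity) ((min_le_right _ _).trans (by linarith)))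

lemma phantomTerm_of_exp_le {n : ℕ} (hn : 1 ≤ n) {x : ℝ} (hx : Real.exp (-1) ≤ x) :
    phantomTerm n x = Real.exp (-(1 / n : ℝ)) := by
  have h1 : 1 ≤ Real.exp 1 * x := by
    calc (1 : ℝ) = Real.exp 1 * Real.exp (-1) := by rw [← Real.exp_add]; simp
      _ ≤ _ := by gcongr
  rw [phantomTerm, min_eq_left (by linarith), mul_one,
    expNegInvGlue_of_pos (by exact_mod_cast hn), one_div]

/-- With `w = e · exp (-n / m)` in place of `e * a n`, the inequality `min 1 (2w - 1) ≤ w` reduces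
the claim to `n w ≤ m`, that is `t exp (1 - t) ≤ 1` at `t = n / m`. -/
lemma mul_min_le {a : ℕ → ℝ} {ε : ℝ} {m : ℕ} (hm : 1 ≤ m) (hε1 : ε ≤ 1 / 10)
    (h : ∀ n : ℕ, |a n - Real.exp (-(n / m : ℝ))| ≤ ε) (n : ℕ) :
    n * min 1 (2 * Real.exp 1 * a n - 1) ≤ (1 + 18 * ε) * m := by
  have hε : 0 ≤ ε := (abs_nonneg _).trans (h 0)
  have hmR : (0 : ℝ) < m := by exact_mod_cast hm
  have he : Real.exp 1 < 2.7182818286 := Real.exp_one_lt_d9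
  have he' : 2.7182818283 < Real.exp 1 := Real.exp_one_gt_d9
  have hn := (abs_le.1 (h n)).2
  -- The approximation error is multiplied by `n`, so this comparison is useful only for `n ≤ 3m`,
  -- where it yields `3m · 6ε`. For larger `n`, `a n` is below the cutoff `1/(2e)` and the minimum
  -- is nonpositive.
  rcases le_total (n : ℝ) (3 * m) with h3 | h3
  · obtain ⟨w, hw⟩ : ∃ w, w = Real.exp 1 * Real.exp (-(n / m : ℝ)) := ⟨_, rfl⟩
    have h1 : min 1 (2 * Real.exp 1 * a n - 1) ≤ w + 6 * ε := by
      have h2 : Real.exp 1 * a n ≤ w + 3 * ε := by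
        calc Real.exp 1 * a n ≤ Real.exp 1 * (Real.exp (-(n / m : ℝ)) + ε) := by
              gcongr; linarith
          _ = w + Real.exp 1 * ε := by rw [hw]; ring
          _ ≤ w + 3 * ε := by gcongr; linarith
      rcases le_total 1 w with h4 | h4
      · exact (min_le_left _ _).trans (by linarith)
      · exact (min_le_right _ _).trans (by linarith)
    have h2 : n * w ≤ m := by
      have h4 := Real.mul_exp_neg_le_exp_neg_one (n / m : ℝ)
      have h5 : (n / m : ℝ) * w ≤ 1 := by
        calc (n / m : ℝ) * w = Real.exp 1 * (n / m * Real.exp (-(n / m : ℝ))) := by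
              rw [hw]; ring
          _ ≤ Real.exp 1 * Real.exp (-1) := by gcongr
          _ = 1 := by rw [← Real.exp_add]; simp
      calc n * w = m * (n / m * w) := by field_simp
        _ ≤ m * 1 := by gcongr
        _ = m := mul_one _
    calc _ ≤ n * (w + 6 * ε) := by gcongr
      _ = n * w + n * (6 * ε) := by ring
      _ ≤ m + 3 * m * (6 * ε) := by gcongr
      _ = _ := by ring
  · have h4 : Real.exp (-(n / m : ℝ)) ≤ Real.exp (-3) := by
      rw [Real.exp_le_exp, neg_le_neg_iff, le_div_iff₀ hmR]
      exact h3
    have h5 : Real.exp 1 * Real.exp (-3) ≤ 1 / 7 := by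
      have : Real.exp 1 * Real.exp (-3) = (Real.exp 1 * Real.exp 1)⁻¹ := by
        rw [← Real.exp_add, ← Real.exp_add, ← Real.exp_neg]; norm_num
      rw [this, inv_le_comm₀ (by positivity) (by norm_num)]
      nlinarith
    have h6 : Real.exp 1 * a n ≤ Real.exp 1 * (Real.exp (-3) + 1 / 10) := by
      gcongr; linarith
    have h7 : min 1 (2 * Real.exp 1 * a n - 1) ≤ 0 :=
      (min_le_right _ _).trans (by nlinarith)
    exact (mul_nonpos_of_nonneg_of_nonpos (by positivity) h7).trans (by positivity)

lemma phantomTerm_le {a : ℕ → ℝ} {ε : ℝ} {m : ℕ} (hm : 1 ≤ m) (hε1 : ε ≤ 1 / 10)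
    (h : ∀ n : ℕ, |a n - Real.exp (-(n / m : ℝ))| ≤ ε) (n : ℕ) :
    phantomTerm n (a n) ≤ Real.exp (-((1 + 18 * ε) * m : ℝ)⁻¹) := by
  have hε : 0 ≤ ε := (abs_nonneg _).trans (h 0)
  rw [← expNegInvGlue_of_pos (by positivity)]
  exact expNegInvGlue.monotone (mul_min_le hm hε1 h n)

/-- If `a n` is uniformly close to `exp (- n / m)`, it is uniformly close to the powers of the
supremum of the `phantomTerm`s. -/
lemma abs_sub_iSup_phantomTerm_pow_le {a : ℕ → ℝ} {ε : ℝ} {m : ℕ} (hm : 1 ≤ m)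
    (hε1 : ε ≤ 1 / 10) (hm1 : Real.exp (-1) ≤ a m)
    (h : ∀ n : ℕ, |a n - Real.exp (-(n / m : ℝ))| ≤ ε) (n : ℕ) :
    |a n - (⨆ k, phantomTerm k (a k)) ^ n| ≤ 19 * ε := by
  have hε : 0 ≤ ε := (abs_nonneg _).trans (h 0)
  have hup := phantomTerm_le hm hε1 h
  have hmR : (0 : ℝ) < m := by exact_mod_cast hm
  set g := ⨆ k, phantomTerm k (a k) with hg
  have h1 : g ≤ Real.exp (-((1 + 18 * ε) * m : ℝ)⁻¹) := ciSup_le hup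
  have h2 : Real.exp (-(1 / m : ℝ)) ≤ g := by
    rw [← phantomTerm_of_exp_le hm hm1]
    exact le_ciSup (f := fun k => phantomTerm k (a k)) ⟨_, Set.forall_mem_range.2 hup⟩ m
  have h3 : Real.exp (-(n / m : ℝ)) ≤ g ^ n := by
    calc _ = Real.exp (-(1 / m : ℝ)) ^ n := by rw [← Real.exp_nat_mul]; congr 1; ring
      _ ≤ _ := by gcongr
  obtain ⟨z, hz⟩ : ∃ z : ℝ, z = n / ((1 + 18 * ε) * m) := ⟨_, rfl⟩
  have hg0 : 0 ≤ g := (Real.exp_pos _).le.trans h2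
  have h4 : g ^ n ≤ Real.exp (-z) := by
    calc _ ≤ Real.exp (-((1 + 18 * ε) * m : ℝ)⁻¹) ^ n := by gcongr
      _ = _ := by rw [← Real.exp_nat_mul, hz]; congr 1; ring
  have h5 : (n / m : ℝ) = z + 18 * ε * z := by rw [hz]; field_simp
  -- The gap is at most `18 ε z exp (-z)`, and `z exp (-z) ≤ 1` makes this uniform in `n`.
  have h6 : Real.exp (-z) - Real.exp (-(n / m : ℝ)) ≤ 18 * ε := by
    rw [h5, neg_add, Real.exp_add]
    have e1 := Real.add_one_le_exp (-(18 * ε * z))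
    have e2 := Real.mul_exp_neg_le_exp_neg_one z
    have e3 : Real.exp (-1) ≤ 1 := by simp
    have e4 := Real.exp_pos (-z)
    nlinarith
  have h7 := abs_le.1 (h n)
  rw [abs_le]
  constructor <;> linarith

/-! ### Lipschitz approximation of indicators. -/

/-- The probability that no `X j` with `j ∈ S` exceeds `u`. -/
noncomputable def probLE {Ω : Type*} [MeasurableSpace Ω] (X : ℕ → Ω → ℝ) (μ : Measure Ω)
    (S : Finset ℕ) (u : ℝ) : ℝ :=
  μ.real {ω | ∀ j ∈ S, X j ω ≤ u}

/-- A Lipschitz approximation of the indicator function of `{x | ∀ a, x a ≤ u}`. -/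
noncomputable def ramp (s : ℕ) (u δ : ℝ) (x : Fin s → ℝ) : ℝ :=
  max 0 (1 - (∑ a, max 0 (x a - u)) / δ)

lemma ramp_nonneg (s : ℕ) (u δ : ℝ) (x : Fin s → ℝ) : 0 ≤ ramp s u δ x := le_max_left _ _

lemma ramp_le_one {s : ℕ} {u δ : ℝ} (hδ : 0 < δ) (x : Fin s → ℝ) : ramp s u δ x ≤ 1 := by
  have : 0 ≤ (∑ a, max 0 (x a - u)) / δ :=
    div_nonneg (Finset.sum_nonneg fun a _ => le_max_left _ _) hδ.le
  exact max_le zero_le_one (by linarith)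

lemma ramp_eq_one {s : ℕ} {u δ : ℝ} {x : Fin s → ℝ} (hx : ∀ a, x a ≤ u) : ramp s u δ x = 1 := by
  have : ∑ a, max 0 (x a - u) = 0 :=
    Finset.sum_eq_zero fun a _ => max_eq_left (by linarith [hx a])
  simp [ramp, this]

lemma ramp_eq_zero {s : ℕ} {u δ : ℝ} (hδ : 0 < δ) {x : Fin s → ℝ} {a : Fin s}
    (hx : u + δ ≤ x a) : ramp s u δ x = 0 := by
  have h1 : δ ≤ ∑ a, max 0 (x a - u) := by
    refine le_trans ?_ (Finset.single_le_sum (f := fun a => max 0 (x a - u))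
      (fun a _ => le_max_left _ _) (Finset.mem_univ a))
    exact le_max_of_le_right (by linarith)
  have h2 : 1 ≤ (∑ a, max 0 (x a - u)) / δ := (one_le_div hδ).2 h1
  exact max_eq_left (by linarith)

lemma continuous_ramp (s : ℕ) (u δ : ℝ) : Continuous (ramp s u δ) := by
  unfold ramp
  fun_prop

lemma isTestFunction_ramp {s : ℕ} (hs : 0 < s) {u δ : ℝ} (hδ : 0 < δ) :
    IsTestFunction (ramp s u δ) where
  measurable := (continuous_ramp s u δ).measurable
  abs_le_one x := by rw [abs_of_nonneg (ramp_nonneg _ _ _ _)]; exact ramp_le_one hδ x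
  nonconstant := by
    refine ⟨fun _ => u, fun _ => u + δ, ?_⟩
    rw [ramp_eq_one fun _ => le_rfl, ramp_eq_zero hδ (a := ⟨0, hs⟩) le_rfl]
    exact one_ne_zero

lemma abs_ramp_sub_le {s : ℕ} {u δ : ℝ} (hδ : 0 < δ) (x y : Fin s → ℝ) :
    |ramp s u δ y - ramp s u δ x| ≤ (∑ a, |y a - x a|) / δ := by
  refine (abs_max_sub_max_le_max _ _ _ _).trans ?_
  rw [sub_self, abs_zero, max_eq_right (abs_nonneg _), sub_sub_sub_cancel_left, ← sub_div,
    abs_div, abs_of_pos hδ]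
  gcongr
  rw [← Finset.sum_sub_distrib]
  refine (Finset.abs_sum_le_sum_abs _ _).trans (Finset.sum_le_sum fun a _ => ?_)
  refine (abs_max_sub_max_le_max _ _ _ _).trans ?_
  rw [sub_self, abs_zero, max_eq_right (abs_nonneg _), sub_sub_sub_cancel_right, abs_sub_comm]

lemma lipCoeff_ramp_le {s : ℕ} {u δ : ℝ} (hδ : 0 < δ) :
    lipCoeff (ramp s u δ) ≤ ENNReal.ofReal (1 / δ) := by
  refine iSup_le fun x => iSup_le fun y => iSup_le fun _ => ENNReal.ofReal_le_ofReal ?_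
  refine div_le_of_le_mul₀ (Finset.sum_nonneg fun a _ => abs_nonneg _) (by positivity) ?_
  rw [one_div_mul_eq_div]
  exact abs_ramp_sub_le hδ x y

/-- The ramp function evaluated at the variables with index in `S`. -/
noncomputable def rampAt {Ω : Type*} (X : ℕ → Ω → ℝ) (S : Finset ℕ) (u δ : ℝ) (ω : Ω) : ℝ :=
  ramp S.card u δ fun a => X (S.orderEmbOfFin rfl a) ω

lemma rampAt_nonneg {Ω : Type*} {X : ℕ → Ω → ℝ} (S : Finset ℕ) (u δ : ℝ) (ω : Ω) :
    0 ≤ rampAt X S u δ ω :=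
  ramp_nonneg _ _ _ _

lemma rampAt_le_one {Ω : Type*} {X : ℕ → Ω → ℝ} (S : Finset ℕ) {u δ : ℝ} (hδ : 0 < δ) (ω : Ω) :
    rampAt X S u δ ω ≤ 1 :=
  ramp_le_one hδ _

lemma indicator_le_rampAt {Ω : Type*} {X : ℕ → Ω → ℝ} (S : Finset ℕ) {u δ : ℝ} (ω : Ω) :
    {ω | ∀ j ∈ S, X j ω ≤ u}.indicator 1 ω ≤ rampAt X S u δ ω := by
  by_cases h : ω ∈ {ω | ∀ j ∈ S, X j ω ≤ u}
  · rw [Set.indicator_of_mem h]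
    exact (ramp_eq_one fun a => h _ (S.orderEmbOfFin_mem rfl a)).ge
  · rw [Set.indicator_of_notMem h]
    exact ramp_nonneg _ _ _ _

lemma rampAt_le_indicator {Ω : Type*} {X : ℕ → Ω → ℝ} (S : Finset ℕ) {u δ : ℝ} (hδ : 0 < δ) (ω : Ω) :
    rampAt X S u δ ω ≤ {ω | ∀ j ∈ S, X j ω ≤ u + δ}.indicator 1 ω := by
  by_cases h : ω ∈ {ω | ∀ j ∈ S, X j ω ≤ u + δ}
  · rw [Set.indicator_of_mem h]; exact rampAt_le_one S hδ ω
  · rw [Set.indicator_of_notMem h]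
    simp only [Set.mem_ofPred_eq, not_forall, not_le] at h
    obtain ⟨j, hj, hlt⟩ := h
    obtain ⟨a, rfl⟩ : ∃ a, S.orderEmbOfFin rfl a = j := by
      have : j ∈ Set.range (S.orderEmbOfFin rfl) := by rw [Finset.range_orderEmbOfFin]; exact hj
      exact this
    exact (ramp_eq_zero hδ hlt.le).le

/-! ### From η-dependence to asymptotic independence of distant blocks. -/

section

variable {Ω : Type*} [MeasurableSpace Ω] {μ : Measure Ω} {X : ℕ → Ω → ℝ}

lemma abs_covariance_le_of_etaCoeff_le {r s t : ℕ} {c D : ℝ} (hc : 0 ≤ c) (hD : 0 ≤ D)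
    (hη : etaCoeff X μ r ≤ ENNReal.ofReal c) {f : (Fin s → ℝ) → ℝ} {g : (Fin t → ℝ) → ℝ}
    (hf : IsTestFunction f) (hg : IsTestFunction g) (hfD : lipCoeff f ≤ ENNReal.ofReal D)
    (hgD : lipCoeff g ≤ ENNReal.ofReal D) {i : Fin s → ℕ} {j : Fin t → ℕ} (hi : Monotone i)
    (hj : Monotone j) (hij : ∀ a b, i a + r ≤ j b) :
    |cov[fun ω => f (fun a => X (i a) ω), fun ω => g (fun b => X (j b) ω); μ]| ≤
      c * ((s + t) * D) := by
  set κ := |cov[fun ω => f (fun a => X (i a) ω), fun ω => g (fun b => X (j b) ω); μ]|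
  have h1 : ENNReal.ofReal κ / ((s : ℝ≥0∞) * lipCoeff f + (t : ℝ≥0∞) * lipCoeff g) ≤
      etaCoeff X μ r := by
    unfold etaCoeff
    refine le_iSup_of_le s <| le_iSup_of_le t <| le_iSup_of_le f <| le_iSup_of_le g <|
      le_iSup_of_le hf <| le_iSup_of_le hg <| le_iSup_of_le i <| le_iSup_of_le j <|
      le_iSup_of_le hi <| le_iSup_of_le hj <| le_iSup_of_le hij le_rfl
  have h2 : (s : ℝ≥0∞) * lipCoeff f + (t : ℝ≥0∞) * lipCoeff g ≤
      ENNReal.ofReal ((s + t) * D) := by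
    rw [add_mul, ENNReal.ofReal_add (by positivity) (by positivity),
      ENNReal.ofReal_mul (by positivity), ENNReal.ofReal_mul (by positivity),
      ENNReal.ofReal_natCast, ENNReal.ofReal_natCast]
    gcongr
  have h3 := (ENNReal.div_le_iff_le_mul (Or.inr ENNReal.ofReal_ne_top)
    (Or.inl (h2.trans_lt ENNReal.ofReal_lt_top).ne)).1 (h1.trans hη)
  rw [← ENNReal.ofReal_le_ofReal_iff (by positivity), ENNReal.ofReal_mul hc]
  exact h3.trans (by gcongr)

lemma measurableSet_forall_le (hX : ∀ j, Measurable (X j)) (S : Finset ℕ) (u : ℝ) :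
    MeasurableSet {ω | ∀ j ∈ S, X j ω ≤ u} := by
  have : {ω | ∀ j ∈ S, X j ω ≤ u} = ⋂ j ∈ S, {ω | X j ω ≤ u} := by ext; simp
  rw [this]
  exact Finset.measurableSet_biInter S fun j _ => measurableSet_le (hX j) measurable_const

lemma probLE_nonneg (S : Finset ℕ) (u : ℝ) : 0 ≤ probLE X μ S u := measureReal_nonneg

lemma probLE_shift (hstat : IsStationary X μ) (S : Finset ℕ)
    (k : ℕ) (u : ℝ) : probLE X μ (S.map (addRightEmbedding k)) u = probLE X μ S u := by
  have hm : MeasurableSet {x : ℕ → ℝ | ∀ j ∈ S, x j ≤ u} :=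
    measurableSet_forall_le (fun j => measurable_pi_apply j) S u
  have := (hstat k).measure_mem_eq hm
  simp only [probLE, measureReal_def]
  congr 1
  simpa using this

lemma marginalDF_le_one (u : ℝ) : marginalDF X μ u ≤ 1 := cdf_le_one _ _

lemma marginalDF_nonneg (u : ℝ) : 0 ≤ marginalDF X μ u := cdf_nonneg _ _

lemma measurable_rampAt (hX : ∀ j, Measurable (X j)) (S : Finset ℕ) (u δ : ℝ) :
    Measurable (rampAt X S u δ) :=
  (continuous_ramp _ _ _).measurable.comp (measurable_pi_lambda _ fun _ => hX _)

lemma abs_covariance_rampAt_le {r : ℕ} {c δ u : ℝ} (hc : 0 ≤ c) (hδ : 0 < δ)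
    (hη : etaCoeff X μ r ≤ ENNReal.ofReal c) {S T : Finset ℕ} (hS : S.Nonempty)
    (hT : T.Nonempty) (hST : ∀ i ∈ S, ∀ j ∈ T, i + r ≤ j) :
    |cov[rampAt X S u δ, rampAt X T u δ; μ]| ≤ c * ((S.card + T.card) * (1 / δ)) :=
  abs_covariance_le_of_etaCoeff_le hc (by positivity) hη
    (isTestFunction_ramp hS.card_pos hδ) (isTestFunction_ramp hT.card_pos hδ)
    (lipCoeff_ramp_le hδ) (lipCoeff_ramp_le hδ) (S.orderEmbOfFin rfl).monotone
    (T.orderEmbOfFin rfl).monotone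
    fun _ _ => hST _ (S.orderEmbOfFin_mem rfl _) _ (T.orderEmbOfFin_mem rfl _)

variable [IsProbabilityMeasure μ]

lemma probLE_le_one (S : Finset ℕ) (u : ℝ) : probLE X μ S u ≤ 1 := measureReal_le_one

@[simp] lemma probLE_empty (u : ℝ) : probLE X μ ∅ u = 1 := by simp [probLE]

lemma probLE_mono (S : Finset ℕ) : Monotone (probLE X μ S) := fun _ _ h =>
  measureReal_mono fun _ hω j hj => (hω j hj).trans h

lemma probLE_anti {S T : Finset ℕ} (h : S ⊆ T) (u : ℝ) : probLE X μ T u ≤ probLE X μ S u :=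
  measureReal_mono fun _ hω j hj => hω j (h hj)

lemma marginalDF_eq_probLE (hX : ∀ j, Measurable (X j)) (hstat : IsStationary X μ) (j : ℕ)
    (u : ℝ) : marginalDF X μ u = probLE X μ {j} u := by
  have h1 : probLE X μ {j} u = probLE X μ {0} u := by
    rw [← probLE_shift hstat {0} j u]; simp
  have : IsProbabilityMeasure (μ.map (X 0)) := Measure.isProbabilityMeasure_map (hX 0).aemeasurable
  rw [h1, marginalDF, cdf_eq_real, map_measureReal_apply (hX 0) measurableSet_Iic]
  simp [probLE, Set.preimage]

lemma probLE_sub_probLE_union_le (hX : ∀ j, Measurable (X j)) (hstat : IsStationary X μ)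
    (S T : Finset ℕ) (u : ℝ) :
    probLE X μ S u - probLE X μ (S ∪ T) u ≤ T.card * (1 - marginalDF X μ u) := by
  have h1 : {ω | ∀ j ∈ S, X j ω ≤ u} ⊆
      {ω | ∀ j ∈ S ∪ T, X j ω ≤ u} ∪ ⋃ j ∈ T, {ω | X j ω ≤ u}ᶜ := by
    intro ω hω
    simp only [Set.mem_ofPred_eq, Set.mem_union, Set.mem_iUnion, Set.mem_compl_iff] at hω ⊢
    by_contra! h
    obtain ⟨⟨j, hj, hj'⟩, h2⟩ := h
    rcases Finset.mem_union.1 hj with h | h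
    · exact absurd (hω j h) (not_le.2 hj')
    · exact absurd (h2 j h) (not_le.2 hj')
  have h2 : ∀ j ∈ T, μ.real {ω | X j ω ≤ u}ᶜ ≤ 1 - marginalDF X μ u := fun j _ => by
    rw [probReal_compl_eq_one_sub (measurableSet_le (hX j) measurable_const),
      marginalDF_eq_probLE hX hstat j]
    simp [probLE]
  have h3 := (measureReal_mono h1).trans (measureReal_union_le (μ := μ) _ _)
  have h4 := (measureReal_biUnion_finset_le (μ := μ) T fun j => {ω | X j ω ≤ u}ᶜ).trans
    (Finset.sum_le_card_nsmul _ _ _ h2)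
  rw [nsmul_eq_mul] at h4
  simp only [probLE]
  linarith

lemma probLE_sub_probLE_le (hX : ∀ j, Measurable (X j)) (hstat : IsStationary X μ)
    (S : Finset ℕ) {u v : ℝ} (huv : u ≤ v) :
    probLE X μ S v - probLE X μ S u ≤ S.card * (marginalDF X μ v - marginalDF X μ u) := by
  have h1 : {ω | ∀ j ∈ S, X j ω ≤ v} ⊆
      {ω | ∀ j ∈ S, X j ω ≤ u} ∪ ⋃ j ∈ S, ({ω | X j ω ≤ v} \ {ω | X j ω ≤ u}) := by
    intro ω hω
    simp only [Set.mem_ofPred_eq, Set.mem_union, Set.mem_iUnion, Set.mem_sdiff] at hω ⊢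
    by_contra! h
    obtain ⟨⟨j, hj, hj'⟩, h2⟩ := h
    exact absurd (h2 j hj (hω j hj)) (not_le.2 hj')
  have h2 : ∀ j ∈ S, μ.real ({ω | X j ω ≤ v} \ {ω | X j ω ≤ u}) ≤
      marginalDF X μ v - marginalDF X μ u := fun j _ => by
    rw [measureReal_sdiff (s₁ := {ω | X j ω ≤ v}) (s₂ := {ω | X j ω ≤ u})
      (fun ω h => le_trans h huv)
      (measurableSet_le (hX j) measurable_const),
      marginalDF_eq_probLE hX hstat j, marginalDF_eq_probLE hX hstat j]
    simp [probLE]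
  have h3 := (measureReal_mono h1).trans (measureReal_union_le (μ := μ) _ _)
  have h4 := (measureReal_biUnion_finset_le (μ := μ) S
    fun j => {ω | X j ω ≤ v} \ {ω | X j ω ≤ u}).trans (Finset.sum_le_card_nsmul _ _ _ h2)
  rw [nsmul_eq_mul] at h4
  simp only [probLE]
  linarith

lemma continuous_probLE (hX : ∀ j, Measurable (X j)) (hstat : IsStationary X μ)
    (hcont : Continuous (marginalDF X μ)) (S : Finset ℕ) : Continuous (probLE X μ S) := by
  have key : ∀ u v, |probLE X μ S v - probLE X μ S u| ≤
      S.card * |marginalDF X μ v - marginalDF X μ u| := by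
    intro u v
    wlog h : u ≤ v generalizing u v
    · rw [abs_sub_comm, abs_sub_comm (marginalDF X μ v)]
      exact this v u (le_of_not_ge h)
    rw [abs_of_nonneg (sub_nonneg.2 (probLE_mono S h))]
    exact (probLE_sub_probLE_le hX hstat S h).trans (by gcongr; exact le_abs_self _)
  rw [continuous_iff_continuousAt]
  intro u
  rw [ContinuousAt, tendsto_iff_dist_tendsto_zero]
  have h1 : Tendsto (fun v => S.card * |marginalDF X μ v - marginalDF X μ u|) (𝓝 u) (𝓝 0) := by
    have : Continuous fun v => S.card * |marginalDF X μ v - marginalDF X μ u| := by fun_prop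
    simpa using this.tendsto u
  exact squeeze_zero (fun _ => dist_nonneg) (fun v => key u v) h1

lemma memLp_two_rampAt (hX : ∀ j, Measurable (X j)) (S : Finset ℕ) (u : ℝ) {δ : ℝ} (hδ : 0 < δ) :
    MemLp (rampAt X S u δ) 2 μ :=
  MemLp.of_bound (measurable_rampAt hX S u δ).aestronglyMeasurable 1 <| ae_of_all _ fun ω => by
    rw [Real.norm_of_nonneg (rampAt_nonneg S u δ ω)]; exact rampAt_le_one S hδ ω

lemma probLE_le_integral_rampAt (hX : ∀ j, Measurable (X j)) (S : Finset ℕ) (u : ℝ) {δ : ℝ}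
    (hδ : 0 < δ) : probLE X μ S u ≤ ∫ ω, rampAt X S u δ ω ∂μ := by
  rw [probLE, ← integral_indicator_one (measurableSet_forall_le hX S u)]
  exact integral_mono ((integrable_const 1).indicator (measurableSet_forall_le hX S u))
    ((memLp_two_rampAt hX S u hδ).integrable one_le_two) fun ω => indicator_le_rampAt S ω

lemma integral_rampAt_le_probLE (hX : ∀ j, Measurable (X j)) (S : Finset ℕ) (u : ℝ) {δ : ℝ}
    (hδ : 0 < δ) : ∫ ω, rampAt X S u δ ω ∂μ ≤ probLE X μ S (u + δ) := by
  rw [probLE, ← integral_indicator_one (measurableSet_forall_le hX S (u + δ))]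
  exact integral_mono ((memLp_two_rampAt hX S u hδ).integrable one_le_two)
    ((integrable_const 1).indicator (measurableSet_forall_le hX S (u + δ)))
    fun ω => rampAt_le_indicator S hδ ω

lemma indicator_forall_union {Ω : Type*} (X : ℕ → Ω → ℝ) (S T : Finset ℕ) (u : ℝ) (ω : Ω) :
    {ω | ∀ j ∈ S ∪ T, X j ω ≤ u}.indicator (1 : Ω → ℝ) ω =
      {ω | ∀ j ∈ S, X j ω ≤ u}.indicator 1 ω * {ω | ∀ j ∈ T, X j ω ≤ u}.indicator 1 ω := by
  have : {ω | ∀ j ∈ S ∪ T, X j ω ≤ u} = {ω | ∀ j ∈ S, X j ω ≤ u} ∩ {ω | ∀ j ∈ T, X j ω ≤ u} := by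
    ext ω
    simp only [Finset.mem_union, Set.mem_ofPred_eq, Set.mem_inter_iff, or_imp, forall_and]
  rw [this, Set.inter_indicator_one, Pi.mul_apply]

lemma integrable_rampAt_mul (hX : ∀ j, Measurable (X j)) (S T : Finset ℕ) (u : ℝ) {δ : ℝ}
    (hδ : 0 < δ) : Integrable (rampAt X S u δ * rampAt X T u δ) μ :=
  (memLp_two_rampAt hX S u hδ).integrable_mul (memLp_two_rampAt hX T u hδ)

lemma probLE_union_le_integral (hX : ∀ j, Measurable (X j)) (S T : Finset ℕ) (u : ℝ) {δ : ℝ}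
    (hδ : 0 < δ) :
    probLE X μ (S ∪ T) u ≤ ∫ ω, (rampAt X S u δ * rampAt X T u δ) ω ∂μ := by
  rw [probLE, ← integral_indicator_one (measurableSet_forall_le hX _ u)]
  refine integral_mono ((integrable_const 1).indicator (measurableSet_forall_le hX _ u))
    (integrable_rampAt_mul hX S T u hδ) fun ω => ?_
  rw [indicator_forall_union]
  exact mul_le_mul (indicator_le_rampAt S ω) (indicator_le_rampAt T ω)
    (Set.indicator_nonneg (fun _ _ => zero_le_one) _) (rampAt_nonneg _ _ _ _)

lemma integral_le_probLE_union (hX : ∀ j, Measurable (X j)) (S T : Finset ℕ) (u : ℝ) {δ : ℝ}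
    (hδ : 0 < δ) :
    ∫ ω, (rampAt X S u δ * rampAt X T u δ) ω ∂μ ≤ probLE X μ (S ∪ T) (u + δ) := by
  rw [probLE, ← integral_indicator_one (measurableSet_forall_le hX _ (u + δ))]
  refine integral_mono (integrable_rampAt_mul hX S T u hδ)
    ((integrable_const 1).indicator (measurableSet_forall_le hX _ _)) fun ω => ?_
  rw [indicator_forall_union]
  exact mul_le_mul (rampAt_le_indicator S hδ ω) (rampAt_le_indicator T hδ ω)
    (rampAt_nonneg _ _ _ _) (Set.indicator_nonneg (fun _ _ => zero_le_one) _)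

/-- The ramps lie between the indicators at levels `u` and `u + δ`. In each direction only one side
of the comparison has to be moved back from `u + δ` to `u`, hence a single term `(S.card + T.card) *
e` beside the covariance bound. -/
lemma abs_probLE_union_sub_le_of_etaCoeff_le (hX : ∀ j, Measurable (X j))
    (hstat : IsStationary X μ) {r : ℕ} {c δ e u : ℝ} (hc : 0 ≤ c) (hδ : 0 < δ)
    (hη : etaCoeff X μ r ≤ ENNReal.ofReal c)
    (he : marginalDF X μ (u + δ) - marginalDF X μ u ≤ e) {S T : Finset ℕ} (hS : S.Nonempty)
    (hT : T.Nonempty) (hST : ∀ i ∈ S, ∀ j ∈ T, i + r ≤ j) :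
    |probLE X μ (S ∪ T) u - probLE X μ S u * probLE X μ T u| ≤
      (S.card + T.card) * (c / δ + e) := by
  have hcov := abs_covariance_rampAt_le (u := u) hc hδ hη hS hT hST
  rw [covariance_eq_sub (memLp_two_rampAt hX S u hδ) (memLp_two_rampAt hX T u hδ), abs_le] at hcov
  have huδ : u ≤ u + δ := by linarith
  have hinc : ∀ R : Finset ℕ, probLE X μ R (u + δ) - probLE X μ R u ≤ R.card * e := fun R =>
    (probLE_sub_probLE_le hX hstat R huδ).trans (by gcongr)
  have he0 : 0 ≤ e := by
    have : marginalDF X μ u ≤ marginalDF X μ (u + δ) := by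
      rw [marginalDF_eq_probLE hX hstat 0, marginalDF_eq_probLE hX hstat 0]
      exact probLE_mono _ huδ
    linarith
  have hU : probLE X μ (S ∪ T) (u + δ) - probLE X μ (S ∪ T) u ≤ (S.card + T.card) * e := by
    refine (hinc _).trans ?_
    gcongr
    exact_mod_cast Finset.card_union_le S T
  have hA := probLE_le_integral_rampAt (μ := μ) hX S u hδ
  have hA' := integral_rampAt_le_probLE (μ := μ) hX S u hδ
  have hB := probLE_le_integral_rampAt (μ := μ) hX T u hδ
  have hB' := integral_rampAt_le_probLE (μ := μ) hX T u hδ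
  have hAB := probLE_union_le_integral (μ := μ) hX S T u hδ
  have hAB' := integral_le_probLE_union (μ := μ) hX S T u hδ
  have hlow : probLE X μ S u * probLE X μ T u ≤
      (∫ ω, rampAt X S u δ ω ∂μ) * ∫ ω, rampAt X T u δ ω ∂μ :=
    mul_le_mul hA hB (probLE_nonneg _ _) ((probLE_nonneg _ _).trans hA)
  have hup : (∫ ω, rampAt X S u δ ω ∂μ) * ∫ ω, rampAt X T u δ ω ∂μ ≤
      probLE X μ S u * probLE X μ T u + (S.card + T.card) * e := by
    have h1 : (∫ ω, rampAt X S u δ ω ∂μ) * ∫ ω, rampAt X T u δ ω ∂μ ≤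
        probLE X μ S (u + δ) * probLE X μ T (u + δ) :=
      mul_le_mul hA' hB' ((probLE_nonneg _ _).trans hB) (probLE_nonneg _ _)
    have h2 := hinc S
    have h3 := hinc T
    have h4 := probLE_le_one (X := X) (μ := μ) T (u + δ)
    have h5 := probLE_le_one (X := X) (μ := μ) S u
    have h6 := probLE_nonneg (X := X) (μ := μ) T (u + δ)
    have h7 := probLE_nonneg (X := X) (μ := μ) S u
    have h8 : (0 : ℝ) ≤ S.card * e := by positivity
    have h9 : (0 : ℝ) ≤ T.card * e := by positivity
    nlinarith
  have hfin : c * ((S.card + T.card) * (1 / δ)) + (S.card + T.card) * e =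
      (S.card + T.card) * (c / δ + e) := by ring
  rw [← hfin, abs_le]
  constructor <;> linarith

/-- Asymptotic independence with a polynomial rate, for all finite index sets at distance `r`. -/
lemma exists_abs_probLE_union_sub_le (hX : ∀ j, Measurable (X j)) (hstat : IsStationary X μ)
    {b β : ℝ} (hb : 0 < b) (hconc : Concentration (marginalDF X μ) b) (hβ : 2 * (1 + 1 / b) < β)
    (hrate : ∃ C : ℝ, ∀ᶠ r : ℕ in atTop,
      etaCoeff X μ r ≤ ENNReal.ofReal (C * (r : ℝ) ^ (-β))) :
    ∃ (θ K : ℝ) (r₀ : ℕ), 2 < θ ∧ 0 < K ∧ ∀ r : ℕ, r₀ ≤ r → ∀ (u : ℝ) (S T : Finset ℕ),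
      (∀ i ∈ S, ∀ j ∈ T, i + r ≤ j) →
      |probLE X μ (S ∪ T) u - probLE X μ S u * probLE X μ T u| ≤
        K * (S.card + T.card) * (r : ℝ) ^ (-θ) := by
  obtain ⟨C, hC⟩ := hrate
  obtain ⟨r₁, hr₁⟩ := eventually_atTop.1 hC
  obtain ⟨B, hB, hBF⟩ := hconc
  have hθ : 2 < β * b / (1 + b) := by
    rw [lt_div_iff₀ (by positivity)]
    calc 2 * (1 + b) = 2 * (1 + 1 / b) * b := by field_simp; ring
      _ < β * b := by gcongr
  refine ⟨β * b / (1 + b), |C| + B, max 1 r₁, hθ, by positivity, ?_⟩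
  intro r hr u S T hST
  have hr0 : (0 : ℝ) < r := by exact_mod_cast (by omega : 0 < r)
  -- A function on `ℝ^0` is constant, hence not a test function; for empty sets the factorisation is
  -- exact.
  rcases S.eq_empty_or_nonempty with rfl | hS
  · simp; positivity
  rcases T.eq_empty_or_nonempty with rfl | hT
  · simp; positivity
  have hη : etaCoeff X μ r ≤ ENNReal.ofReal (|C| * (r : ℝ) ^ (-β)) := by
    refine (hr₁ r (by omega)).trans (ENNReal.ofReal_le_ofReal ?_)
    gcongr
    exact le_abs_self C
  -- This width balances the two errors: `r^(-β) / δ` and `δ^b` both equal `r^(-θ)`.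
  have hδ : (0 : ℝ) < (r : ℝ) ^ (-(β / (1 + b))) := by positivity
  refine (abs_probLE_union_sub_le_of_etaCoeff_le hX hstat (by positivity) hδ hη
    (hBF u _ hδ) hS hT hST).trans_eq ?_
  have h1 : (r : ℝ) ^ (-β) / (r : ℝ) ^ (-(β / (1 + b))) = (r : ℝ) ^ (-(β * b / (1 + b))) := by
    rw [← Real.rpow_sub hr0]; congr 1; field_simp; ring
  have h2 : ((r : ℝ) ^ (-(β / (1 + b)))) ^ b = (r : ℝ) ^ (-(β * b / (1 + b))) := by
    rw [← Real.rpow_mul hr0.le]; congr 1; ring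
  rw [mul_div_assoc, h1, h2]
  ring

end

/-! ### Choice of the gap length. -/

/-- Choice of a gap `r` and of a number `k` of blocks, for a polynomial mixing rate of order
larger than `2`. -/
lemma exists_gap_and_blocks {θ K : ℝ} (hθ : 2 < θ) (hK : 0 < K) (r₀ T : ℕ) {δ : ℝ} (hδ : 0 < δ) :
    ∃ m₀ : ℕ, ∀ m : ℕ, m₀ ≤ m → ∃ r k : ℕ, r₀ ≤ r ∧ 1 ≤ r ∧ k * r ≤ m ∧
      K * k ^ 2 * (r : ℝ) ^ (-θ) ≤ δ ∧ K * (T * m) * (r : ℝ) ^ (-θ) ≤ δ ∧ (r : ℝ) ≤ δ * k := by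
  -- With `r ≈ m^α` and `k ≈ m^(1-α)`, the lower bound on `α` gives `k² r^(-θ) → 0` and the upper
  -- bound gives `r / k → 0`; together they give `αθ > 1`, so `m r^(-θ) → 0`. Such an `α` exists
  -- because `θ > 2`.
  obtain ⟨α, hα1, hα2⟩ : ∃ α : ℝ, 2 / (2 + θ) < α ∧ α < 1 / 2 :=
    exists_between ((div_lt_div_iff₀ (by positivity) (by norm_num)).2 (by linarith))
  have hα0 : 0 < α := lt_trans (by positivity) hα1
  rw [div_lt_iff₀ (by positivity)] at hα1
  have hlim : ∀ y : ℝ, y < 0 → Tendsto (fun m : ℕ => (m : ℝ) ^ y) atTop (𝓝 0) := fun y hy => by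
    simpa [Function.comp_def] using
      (tendsto_rpow_neg_atTop (neg_pos.2 hy)).comp tendsto_natCast_atTop_atTop
  have e1 := ((hlim (2 - 2 * α - α * θ) (by linarith)).const_mul K).eventually
    (ge_mem_nhds (by simpa using hδ))
  have e2 := ((hlim (1 - α * θ) (by nlinarith)).const_mul (K * T)).eventually
    (ge_mem_nhds (by simpa using hδ))
  have e3 := ((hlim (2 * α - 1) (by linarith)).const_mul 8).eventually
    (ge_mem_nhds (by simpa using hδ : (8 : ℝ) * 0 < min δ 1))
  have e4 := ((tendsto_rpow_atTop hα0).comp tendsto_natCast_atTop_atTop).eventually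
    (eventually_ge_atTop (r₀ : ℝ))
  obtain ⟨m₀, hm₀⟩ := eventually_atTop.1 (e1.and (e2.and (e3.and (e4.and (eventually_ge_atTop 1)))))
  refine ⟨m₀, fun m hm => ?_⟩
  obtain ⟨h1, h2, h3, h4, h5⟩ := hm₀ m hm
  simp only [Function.comp_apply] at h4
  have hmR : (1 : ℝ) ≤ m := by exact_mod_cast h5
  have hm0 : (0 : ℝ) < m := by linarith
  obtain ⟨x, hx⟩ : ∃ x, x = (m : ℝ) ^ α := ⟨_, rfl⟩
  have hx1 : 1 ≤ x := hx ▸ Real.one_le_rpow hmR hα0.le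
  obtain ⟨r, hr⟩ : ∃ r, r = ⌈x⌉₊ := ⟨_, rfl⟩
  have hxr : x ≤ r := hr ▸ Nat.le_ceil x
  have hrx : (r : ℝ) ≤ 2 * x := by
    have := Nat.ceil_lt_add_one (zero_le_one.trans hx1)
    rw [hr]; linarith
  have hr1 : 1 ≤ r := by exact_mod_cast hx1.trans hxr
  have hr0 : (0 : ℝ) < r := by exact_mod_cast hr1
  obtain ⟨k, hk⟩ : ∃ k, k = m / r := ⟨_, rfl⟩
  have hkr : k * r ≤ m := hk ▸ Nat.div_mul_le_self m r
  have hkr' : m < r * (k + 1) := hk ▸ Nat.lt_mul_div_succ m hr1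
  have hkrR : (k : ℝ) * r ≤ m := by exact_mod_cast hkr
  have hkrR' : (m : ℝ) ≤ r * (k + 1) := by exact_mod_cast hkr'.le
  have hxθ : (r : ℝ) ^ (-θ) ≤ (m : ℝ) ^ (-(α * θ)) := by
    calc (r : ℝ) ^ (-θ) ≤ x ^ (-θ) :=
          Real.rpow_le_rpow_of_nonpos (by linarith) hxr (by linarith)
      _ = _ := by rw [hx, ← Real.rpow_mul hm0.le]; congr 1; ring
  have hkx : (k : ℝ) ≤ (m : ℝ) ^ (1 - α) := by
    rw [Real.rpow_sub hm0, Real.rpow_one, ← hx, le_div_iff₀ (by linarith)]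
    exact le_trans (by gcongr) hkrR
  have hx2 : 8 * (x * x) ≤ min δ 1 * m := by
    have : (m : ℝ) ^ (2 * α - 1) * m = x * x := by
      rw [Real.rpow_sub hm0, Real.rpow_one, div_mul_cancel₀ _ hm0.ne', two_mul,
        Real.rpow_add hm0, ← hx]
    calc 8 * (x * x) = 8 * (m : ℝ) ^ (2 * α - 1) * m := by rw [← this]; ring
      _ ≤ _ := by gcongr
  have hx3 : 8 * (x * x) ≤ m := hx2.trans
    ((mul_le_mul_of_nonneg_right (min_le_right _ _) hm0.le).trans_eq (one_mul _))
  have hx4 : 8 * (x * x) ≤ δ * m := hx2.trans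
    (mul_le_mul_of_nonneg_right (min_le_left _ _) hm0.le)
  have hmk : (m : ℝ) ≤ 4 * x * k := by
    have : (m : ℝ) ≤ 2 * x * (k + 1) := hkrR'.trans (by gcongr)
    nlinarith
  refine ⟨r, k, by exact_mod_cast (hx ▸ h4).trans hxr, hr1, hkr, ?_, ?_, ?_⟩
  · calc K * k ^ 2 * (r : ℝ) ^ (-θ) ≤ K * ((m : ℝ) ^ (1 - α)) ^ 2 * (m : ℝ) ^ (-(α * θ)) := by
          gcongr
      _ = K * (m : ℝ) ^ (2 - 2 * α - α * θ) := by
          rw [mul_assoc, ← Real.rpow_natCast, ← Real.rpow_mul hm0.le, ← Real.rpow_add hm0]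
          congr 2
          push_cast
          ring
      _ ≤ δ := h1
  · calc K * (T * m) * (r : ℝ) ^ (-θ) ≤ K * (T * m) * (m : ℝ) ^ (-(α * θ)) := by gcongr
      _ = K * T * (m : ℝ) ^ (1 - α * θ) := by
          rw [sub_eq_add_neg, Real.rpow_add hm0, Real.rpow_one]; ring
      _ ≤ δ := h2
  · have : 2 * x * (4 * x) ≤ δ * k * (4 * x) := by nlinarith
    exact hrx.trans (le_of_mul_le_mul_right this (by linarith))

/-! ### Near multiplicativity of the distribution functions of the maxima. -/

section

variable {Ω : Type*} [MeasurableSpace Ω] {μ : Measure Ω} {X : ℕ → Ω → ℝ}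

/-- The distribution function of the maximum of `X 0, …, X (n - 1)`. -/
noncomputable def maxDF (X : ℕ → Ω → ℝ) (μ : Measure Ω) (n : ℕ) (u : ℝ) : ℝ :=
  probLE X μ (Finset.range n) u

lemma maxDF_nonneg (n : ℕ) (u : ℝ) : 0 ≤ maxDF X μ n u := probLE_nonneg _ _

lemma measureReal_partialMax_le {n : ℕ} (hn : 1 ≤ n) (u : ℝ) :
    μ.real {ω | partialMax X n ω ≤ u} = maxDF X μ n u := by
  have : Nonempty (Fin n) := ⟨⟨0, hn⟩⟩
  rw [maxDF, probLE]
  congr 1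
  ext ω
  simp only [partialMax, Set.mem_ofPred_eq, Finset.mem_range]
  rw [ciSup_le_iff (Set.finite_range _).bddAbove, Fin.forall_iff]

/-- The phantom distribution function. -/
noncomputable def phantomDF (X : ℕ → Ω → ℝ) (μ : Measure Ω) (u : ℝ) : ℝ :=
  ⨆ n, phantomTerm n (maxDF X μ n u)

lemma bddAbove_phantomTerm (u : ℝ) :
    BddAbove (Set.range fun n => phantomTerm n (maxDF X μ n u)) :=
  ⟨1, Set.forall_mem_range.2 fun _ => (phantomTerm_lt_one _ _).le⟩

variable [IsProbabilityMeasure μ]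

lemma maxDF_le_one (n : ℕ) (u : ℝ) : maxDF X μ n u ≤ 1 := probLE_le_one _ _

@[simp] lemma maxDF_zero (u : ℝ) : maxDF X μ 0 u = 1 := by simp [maxDF]

lemma monotone_maxDF (n : ℕ) : Monotone (maxDF X μ n) := probLE_mono _

lemma antitone_maxDF (u : ℝ) : Antitone fun n => maxDF X μ n u := fun _ _ h =>
  probLE_anti (Finset.range_mono h) u

lemma maxDF_one (hX : ∀ j, Measurable (X j)) (hstat : IsStationary X μ) (u : ℝ) :
    maxDF X μ 1 u = marginalDF X μ u := by
  rw [marginalDF_eq_probLE hX hstat 0, maxDF, Finset.range_one]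

lemma maxDF_sub_maxDF_add_le (hX : ∀ j, Measurable (X j)) (hstat : IsStationary X μ) (n k : ℕ)
    (u : ℝ) : maxDF X μ n u - maxDF X μ (n + k) u ≤ k * (1 - marginalDF X μ u) := by
  have h1 : Finset.range (n + k) =
      Finset.range n ∪ (Finset.range k).map (addRightEmbedding n) := by
    ext i
    simp only [Finset.mem_range, Finset.mem_union, Finset.mem_map, addRightEmbedding_apply]
    constructor
    · intro h
      by_cases hi : i < n
      · exact Or.inl hi
      · exact Or.inr ⟨i - n, by omega, by omega⟩
    · rintro (h | ⟨j, hj, rfl⟩) <;> omega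
  have := probLE_sub_probLE_union_le hX hstat (Finset.range n)
    ((Finset.range k).map (addRightEmbedding n)) u
  rw [← h1, Finset.card_map, Finset.card_range] at this
  exact this

lemma maxDF_eq_one (hX : ∀ j, Measurable (X j)) (hstat : IsStationary X μ) {u : ℝ}
    (hu : marginalDF X μ u = 1) (n : ℕ) : maxDF X μ n u = 1 := by
  have := maxDF_sub_maxDF_add_le hX hstat 0 n u
  rw [hu, sub_self, mul_zero, zero_add, maxDF_zero] at this
  exact le_antisymm (maxDF_le_one _ _) (by linarith)

/-- The mixing inequality for all index sets at distance `r`, as a property of the rate `ρ`. -/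
def MixesAt (X : ℕ → Ω → ℝ) (μ : Measure Ω) (r : ℕ) (ρ : ℝ) : Prop :=
  ∀ (u : ℝ) (S T : Finset ℕ), (∀ i ∈ S, ∀ j ∈ T, i + r ≤ j) →
    |probLE X μ (S ∪ T) u - probLE X μ S u * probLE X μ T u| ≤ (S.card + T.card) * ρ

/-- If `q ≥ r`, the first `r` variables of the second block are dropped to create a gap. This raises
both the joint probability and the product by at most `r (1 - F u)`, and the two corrections enter
with opposite signs, so they do not add up. If `q < r`, both quantities lie within `r (1 - F u)`
below `maxDF X μ p u`. -/
lemma abs_maxDF_add_sub_le (hX : ∀ j, Measurable (X j)) (hstat : IsStationary X μ) {r : ℕ}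
    {ρ : ℝ} (hρ : 0 ≤ ρ) (hmix : MixesAt X μ r ρ) (p q : ℕ) (u : ℝ) :
    |maxDF X μ (p + q) u - maxDF X μ p u * maxDF X μ q u| ≤
      r * (1 - marginalDF X μ u) + (p + q) * ρ := by
  have hF := marginalDF_le_one (X := X) (μ := μ) u
  have hp1 := maxDF_le_one (X := X) (μ := μ) p u
  have hp0 := maxDF_nonneg (X := X) (μ := μ) p u
  have hpq : maxDF X μ (p + q) u ≤ maxDF X μ p u := antitone_maxDF u (Nat.le_add_right p q)
  rcases le_or_gt r q with hrq | hrq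
  · obtain ⟨q, rfl⟩ := Nat.exists_eq_add_of_le hrq
    set T := (Finset.range q).map (addRightEmbedding (p + r)) with hT
    have h1 := hmix u (Finset.range p) T (by
      intro i hi j hj
      simp only [hT, Finset.mem_range, Finset.mem_map, addRightEmbedding_apply] at hi hj
      obtain ⟨l, _, rfl⟩ := hj
      omega)
    have h2 : probLE X μ T u = maxDF X μ q u := probLE_shift hstat _ _ _
    have h3 : T.card = q := by simp [hT]
    rw [h2, h3, Finset.card_range] at h1
    have h4 : Finset.range (p + (r + q)) =
        (Finset.range p ∪ T) ∪ (Finset.range r).map (addRightEmbedding p) := by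
      ext i
      simp only [hT, Finset.mem_range, Finset.mem_union, Finset.mem_map, addRightEmbedding_apply]
      constructor
      · intro h
        by_cases hi : i < p
        · exact Or.inl (Or.inl hi)
        · by_cases hi' : i < p + r
          · exact Or.inr ⟨i - p, by omega, by omega⟩
          · exact Or.inl (Or.inr ⟨i - (p + r), by omega, by omega⟩)
      · rintro ((h | ⟨j, hj, rfl⟩) | ⟨j, hj, rfl⟩) <;> omega
    have h5 := probLE_sub_probLE_union_le hX hstat (Finset.range p ∪ T)
      ((Finset.range r).map (addRightEmbedding p)) u
    rw [← h4, Finset.card_map, Finset.card_range] at h5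
    have h6 : probLE X μ (Finset.range (p + (r + q))) u ≤ probLE X μ (Finset.range p ∪ T) u :=
      probLE_anti (h4 ▸ Finset.subset_union_left) u
    have h7 := maxDF_sub_maxDF_add_le hX hstat q r u
    have h8 : maxDF X μ (r + q) u ≤ maxDF X μ q u := antitone_maxDF u (Nat.le_add_left q r)
    rw [add_comm q r] at h7
    have h9 : (0 : ℝ) ≤ r * ρ := by positivity
    have h10 : maxDF X μ p u * (maxDF X μ q u - maxDF X μ (r + q) u) ≤
        r * (1 - marginalDF X μ u) := by nlinarith
    have h11 : 0 ≤ maxDF X μ p u * (maxDF X μ q u - maxDF X μ (r + q) u) :=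
      mul_nonneg hp0 (by linarith)
    change _ - maxDF X μ (p + (r + q)) u ≤ _ at h5
    change maxDF X μ (p + (r + q)) u ≤ _ at h6
    change |_ - maxDF X μ p u * _| ≤ _ at h1
    push_cast
    rw [abs_le] at h1 ⊢
    constructor <;> linarith
  · have h1 := maxDF_sub_maxDF_add_le hX hstat p q u
    have h2 := maxDF_sub_maxDF_add_le hX hstat 0 q u
    rw [zero_add, maxDF_zero] at h2
    have h3 := maxDF_le_one (X := X) (μ := μ) q u
    have h4 : (q : ℝ) * (1 - marginalDF X μ u) ≤ r * (1 - marginalDF X μ u) := by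
      have : (q : ℝ) ≤ r := by exact_mod_cast hrq.le
      gcongr
    have h5 : (0 : ℝ) ≤ (p + q) * ρ := by positivity
    have h6 : 0 ≤ maxDF X μ p u * (1 - maxDF X μ q u) := mul_nonneg hp0 (by linarith)
    have h7 : maxDF X μ p u * (1 - maxDF X μ q u) ≤ r * (1 - marginalDF X μ u) := by nlinarith
    rw [abs_le]
    constructor <;> linarith

/-- Only the variables at the multiples `0, r, …, (k - 1) r` are kept. Splitting them off one at a
time costs `(j + 1) ρ` at step `j`, in total at most `k² ρ`. -/
lemma maxDF_le_pow_add (hX : ∀ j, Measurable (X j)) (hstat : IsStationary X μ) {r : ℕ}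
    (hr : 1 ≤ r) {ρ : ℝ} (hρ : 0 ≤ ρ) (hmix : MixesAt X μ r ρ) {k n : ℕ} (hkn : k * r ≤ n)
    (u : ℝ) : maxDF X μ n u ≤ marginalDF X μ u ^ k + k ^ 2 * ρ := by
  have key : ∀ k : ℕ, probLE X μ ((Finset.range k).image (· * r)) u ≤
      marginalDF X μ u ^ k + k ^ 2 * ρ := by
    intro k
    induction k with
    | zero => simp
    | succ k ih =>
      have h1 := hmix u ((Finset.range k).image (· * r)) {k * r} (by
        intro i hi j hj
        simp only [Finset.mem_image, Finset.mem_range, Finset.mem_singleton] at hi hj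
        obtain ⟨l, hl, rfl⟩ := hi
        subst hj
        nlinarith)
      rw [← marginalDF_eq_probLE hX hstat, Finset.card_singleton] at h1
      have h2 : (((Finset.range k).image (· * r)).card : ℝ) ≤ k := by
        exact_mod_cast Finset.card_image_le.trans_eq (Finset.card_range k)
      have h3 : (Finset.range (k + 1)).image (· * r) =
          (Finset.range k).image (· * r) ∪ {k * r} := by
        rw [Finset.range_add_one, Finset.image_insert, Finset.insert_eq, Finset.union_comm]
      have h4 := (abs_le.1 h1).2
      have h5 := marginalDF_nonneg (X := X) (μ := μ) u
      have h6 := marginalDF_le_one (X := X) (μ := μ) u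
      have h7 : ((((Finset.range k).image (· * r)).card : ℝ) + (1 : ℕ)) * ρ ≤ (k + 1) * ρ := by
        push_cast; gcongr
      have h8 := mul_le_mul_of_nonneg_right ih h5
      have h9 : (k : ℝ) ^ 2 * ρ * marginalDF X μ u ≤ k ^ 2 * ρ :=
        mul_le_of_le_one_right (by positivity) h6
      have h10 : (0 : ℝ) ≤ k * ρ := by positivity
      rw [h3, pow_succ]
      push_cast
      linarith
  refine (probLE_anti ?_ u).trans (key k)
  intro i hi
  simp only [Finset.mem_image, Finset.mem_range] at hi ⊢
  obtain ⟨l, hl, rfl⟩ := hi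
  calc l * r < k * r := by gcongr
    _ ≤ n := hkn

variable {θ K : ℝ} {r₀ : ℕ}

/-- A lower bound on `P(M_m ≤ u)` forces a small marginal tail: by `maxDF_le_pow_add`, `F(u)^k`
stays away from `0`, so `1 - F u = O(1 / k)`, and `r (1 - F u)` is small because `r / k` is. -/
lemma exists_forall_mixing (hX : ∀ j, Measurable (X j)) (hstat : IsStationary X μ)
    (hθ : 2 < θ) (hK : 0 < K)
    (hmix : ∀ r : ℕ, r₀ ≤ r → MixesAt X μ r (K * (r : ℝ) ^ (-θ))) (T : ℕ) {δ : ℝ} (hδ : 0 < δ) :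
    ∃ m₀ : ℕ, ∀ m : ℕ, m₀ ≤ m → ∀ u, Real.exp (-1) ≤ maxDF X μ m u →
      1 - marginalDF X μ u ≤ δ ∧ ∀ p q, p + q ≤ T * m →
        |maxDF X μ (p + q) u - maxDF X μ p u * maxDF X μ q u| ≤ δ := by
  -- The value `1/6` works since `1/e - 1/6 ≥ 1/6 > exp (-2)`, which forces `k (1 - F u) ≤ 2`.
  obtain ⟨m₀, hm₀⟩ := exists_gap_and_blocks hθ hK r₀ T
    (lt_min (div_pos hδ three_pos) (by norm_num : (0 : ℝ) < 1 / 6))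
  refine ⟨m₀, fun m hm u hu => ?_⟩
  obtain ⟨r, k, hr, hr1, hkm, h1, h2, h3⟩ := hm₀ m hm
  have hF := marginalDF_le_one (X := X) (μ := μ) u
  have hrR : (1 : ℝ) ≤ r := by exact_mod_cast hr1
  have hρ : 0 ≤ K * (r : ℝ) ^ (-θ) := by positivity
  have h4 := maxDF_le_pow_add hX hstat hr1 hρ (hmix r hr) hkm u
  have h5 : (k : ℝ) ^ 2 * (K * (r : ℝ) ^ (-θ)) ≤ 1 / 6 := by
    rw [← mul_assoc, mul_comm _ K]
    exact h1.trans (min_le_right _ _)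
  have he : (1 / 3 : ℝ) ≤ Real.exp (-1) := by
    rw [Real.exp_neg, ← one_div]
    exact one_div_le_one_div_of_le (Real.exp_pos 1) (by linarith [Real.exp_one_lt_d9])
  have h6 : marginalDF X μ u ^ k ≤ Real.exp (-(k * (1 - marginalDF X μ u))) := by
    rw [← mul_neg, Real.exp_nat_mul]
    gcongr
    · exact marginalDF_nonneg u
    · linarith [Real.add_one_le_exp (-(1 - marginalDF X μ u))]
  have h7 : k * (1 - marginalDF X μ u) ≤ 2 := by
    by_contra! h
    have h8 : Real.exp (-(k * (1 - marginalDF X μ u))) ≤ Real.exp (-2) :=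
      Real.exp_le_exp.2 (by linarith)
    have h9 : Real.exp (-2) < 1 / 6 := by
      have : Real.exp (-2) = (Real.exp 1 * Real.exp 1)⁻¹ := by
        rw [← Real.exp_add, ← Real.exp_neg]; norm_num
      rw [this, inv_lt_comm₀ (by positivity) (by norm_num)]
      nlinarith [Real.exp_one_gt_d9]
    linarith
  have h8 : r * (1 - marginalDF X μ u) ≤ 2 * (δ / 3) := by
    calc r * (1 - marginalDF X μ u) ≤ (δ / 3 * k) * (1 - marginalDF X μ u) := by
          refine mul_le_mul_of_nonneg_right (h3.trans ?_) (by linarith)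
          gcongr
          exact min_le_left _ _
      _ = δ / 3 * (k * (1 - marginalDF X μ u)) := by ring
      _ ≤ δ / 3 * 2 := by gcongr
      _ = _ := by ring
  refine ⟨by nlinarith, fun p q hpq => ?_⟩
  refine (abs_maxDF_add_sub_le hX hstat hρ (hmix r hr) p q u).trans ?_
  have h9 : ((p : ℝ) + q) * (K * (r : ℝ) ^ (-θ)) ≤ δ / 3 := by
    have : (p : ℝ) + q ≤ T * m := by exact_mod_cast hpq
    calc _ ≤ (T * m : ℝ) * (K * (r : ℝ) ^ (-θ)) := by gcongr
      _ = K * (T * m) * (r : ℝ) ^ (-θ) := by ring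
      _ ≤ _ := h2.trans (min_le_left _ _)
  linarith

lemma exists_forall_abs_maxDF_sub_exp_le (hX : ∀ j, Measurable (X j)) (hstat : IsStationary X μ)
    (hθ : 2 < θ) (hK : 0 < K)
    (hmix : ∀ r : ℕ, r₀ ≤ r → MixesAt X μ r (K * (r : ℝ) ^ (-θ))) {ε : ℝ} (hε : 0 < ε) :
    ∃ m₀ : ℕ, ∀ m : ℕ, m₀ ≤ m → ∀ u, Real.exp (-1) ≤ maxDF X μ m u →
      maxDF X μ (m + 1) u < Real.exp (-1) →
      ∀ n : ℕ, |maxDF X μ n u - Real.exp (-(n / m : ℝ))| ≤ ε := by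
  obtain ⟨T, m₁, δ, hδ, h⟩ := exists_forall_abs_sub_exp_le hε
  obtain ⟨m₂, hm₂⟩ := exists_forall_mixing hX hstat hθ hK hmix T hδ
  refine ⟨max m₁ m₂, fun m hm u hu hu' => ?_⟩
  obtain ⟨h1, h2⟩ := hm₂ m (le_of_max_le_right hm) u hu
  exact h _ m (antitone_maxDF u) (maxDF_zero u) (fun n => maxDF_nonneg n u)
    (le_of_max_le_left hm)
    (fun n k => (maxDF_sub_maxDF_add_le hX hstat n k u).trans (by gcongr)) hu hu' h2

/-- First `k` is fixed with `F(u)^k < ε / 2`, then the spacing `r` grows until the mixing error `k²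
K r^(-θ)` is below `ε / 2`. -/
lemma exists_maxDF_lt (hX : ∀ j, Measurable (X j)) (hstat : IsStationary X μ)
    (hθ : 2 < θ) (hK : 0 < K)
    (hmix : ∀ r : ℕ, r₀ ≤ r → MixesAt X μ r (K * (r : ℝ) ^ (-θ))) {u : ℝ}
    (hu : marginalDF X μ u < 1) {ε : ℝ} (hε : 0 < ε) : ∃ n, maxDF X μ n u < ε := by
  obtain ⟨k, hk⟩ := exists_pow_lt_of_lt_one (half_pos hε) hu
  have h1 : Tendsto (fun r : ℕ => k ^ 2 * (K * (r : ℝ) ^ (-θ))) atTop (𝓝 0) := by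
    simpa using (((tendsto_rpow_neg_atTop (by linarith : 0 < θ)).comp
      tendsto_natCast_atTop_atTop).const_mul K).const_mul ((k : ℝ) ^ 2)
  obtain ⟨r, hr, hr0, hr1⟩ := ((h1.eventually (gt_mem_nhds (half_pos hε))).and
    ((eventually_ge_atTop r₀).and (eventually_ge_atTop 1))).exists
  refine ⟨k * r, ?_⟩
  have := maxDF_le_pow_add hX hstat hr1 (by positivity) (hmix r hr0) (le_refl (k * r)) u
  linarith

end

/-! ### The phantom distribution function: continuity and convergence. -/

section

variable {Ω : Type*} [MeasurableSpace Ω] {μ : Measure Ω} {X : ℕ → Ω → ℝ}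

lemma phantomTerm_le_phantomDF (n : ℕ) (u : ℝ) :
    phantomTerm n (maxDF X μ n u) ≤ phantomDF X μ u := le_ciSup (bddAbove_phantomTerm u) n

lemma phantomDF_nonneg (u : ℝ) : 0 ≤ phantomDF X μ u :=
  (phantomTerm_nonneg _ _).trans (phantomTerm_le_phantomDF 0 u)

lemma phantomDF_le_one (u : ℝ) : phantomDF X μ u ≤ 1 :=
  ciSup_le fun _ => (phantomTerm_lt_one _ _).le

lemma exists_lt_phantomTerm {y : ℝ} (hy : y < 1) : ∃ n : ℕ, y < phantomTerm n 1 := by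
  have h : Tendsto (fun n : ℕ => Real.exp (-(1 / n : ℝ))) atTop (𝓝 1) := by
    have := (Real.continuous_exp.tendsto _).comp (tendsto_one_div_atTop_nhds_zero_nat (𝕜 := ℝ)).neg
    simpa [Function.comp_def] using this
  obtain ⟨n, h1, h2⟩ := ((h.eventually (lt_mem_nhds hy)).and (eventually_ge_atTop 1)).exists
  exact ⟨n, by rwa [phantomTerm_of_exp_le h2 (by simp)]⟩

lemma eventually_lt_phantomDF {l : Filter ℝ} (h : ∀ n, Tendsto (maxDF X μ n) l (𝓝 1)) {y : ℝ}
    (hy : y < 1) : ∀ᶠ u in l, y < phantomDF X μ u := by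
  obtain ⟨n, hn⟩ := exists_lt_phantomTerm hy
  have := ((continuous_phantomTerm n).tendsto 1).comp (h n)
  filter_upwards [this.eventually (lt_mem_nhds hn)] with u hu
  exact lt_of_lt_of_le hu (phantomTerm_le_phantomDF n u)

lemma tendsto_phantomDF_one {l : Filter ℝ} (h : ∀ n, Tendsto (maxDF X μ n) l (𝓝 1)) :
    Tendsto (phantomDF X μ) l (𝓝 1) :=
  tendsto_order.2 ⟨fun _ hy => eventually_lt_phantomDF h hy,
    fun _ hy => Eventually.of_forall fun u => (phantomDF_le_one u).trans_lt hy⟩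

lemma phantomDF_eq_one {u : ℝ} (h : ∀ n, maxDF X μ n u = 1) : phantomDF X μ u = 1 := by
  refine le_antisymm (phantomDF_le_one u) (le_of_forall_lt fun y hy => ?_)
  obtain ⟨n, hn⟩ := exists_lt_phantomTerm hy
  exact hn.trans_le (h n ▸ phantomTerm_le_phantomDF n u)

variable [IsProbabilityMeasure μ]

lemma monotone_phantomDF : Monotone (phantomDF X μ) := fun _ _ h =>
  ciSup_mono (bddAbove_phantomTerm _) fun n => monotone_phantomTerm n (monotone_maxDF n h)

/-- Terms beyond `N` vanish, as `maxDF X μ n u` decreases in `n`. The strict form of the hypothesis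
is an open condition on `u`, so near such a point one finite maximum of continuous functions
represents the supremum. -/
lemma phantomDF_eq_sup' {N : ℕ} {u : ℝ} (h : 2 * Real.exp 1 * maxDF X μ N u ≤ 1) :
    phantomDF X μ u = (Finset.range (N + 1)).sup' Finset.nonempty_range_add_one
      fun n => phantomTerm n (maxDF X μ n u) := by
  refine le_antisymm (ciSup_le fun n => ?_)
    (Finset.sup'_le _ _ fun n _ => phantomTerm_le_phantomDF n u)
  rcases Nat.lt_or_ge n (N + 1) with hn | hn
  · exact Finset.le_sup' (fun n => phantomTerm n (maxDF X μ n u)) (Finset.mem_range.2 hn)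
  · rw [phantomTerm_eq_zero (le_trans ?_ h)]
    · exact (phantomTerm_nonneg _ _).trans (Finset.le_sup'
        (fun n => phantomTerm n (maxDF X μ n u)) (Finset.mem_range.2 (Nat.succ_pos N)))
    · have : maxDF X μ n u ≤ maxDF X μ N u := antitone_maxDF u (by omega)
      gcongr

lemma phantomDF_lt_one {N : ℕ} {u : ℝ} (h : 2 * Real.exp 1 * maxDF X μ N u ≤ 1) :
    phantomDF X μ u < 1 := by
  rw [phantomDF_eq_sup' h, Finset.sup'_lt_iff]
  exact fun n _ => phantomTerm_lt_one _ _

lemma continuousAt_phantomDF_of_lt {N : ℕ} {u : ℝ} (hc : ∀ n, Continuous (maxDF X μ n))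
    (h : 2 * Real.exp 1 * maxDF X μ N u < 1) : ContinuousAt (phantomDF X μ) u := by
  have h1 : Continuous fun v => (Finset.range (N + 1)).sup' Finset.nonempty_range_add_one
      fun n => phantomTerm n (maxDF X μ n v) :=
    Continuous.finset_sup'_apply _ fun n _ => (continuous_phantomTerm n).comp (hc n)
  refine h1.continuousAt.congr ?_
  have h2 : ∀ᶠ v in 𝓝 u, 2 * Real.exp 1 * maxDF X μ N v < 1 :=
    ((continuous_const.mul (hc N)).tendsto u).eventually (gt_mem_nhds h)
  filter_upwards [h2] with v hv
  exact (phantomDF_eq_sup' hv.le).symm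

lemma tendsto_maxDF_atTop (hX : ∀ j, Measurable (X j)) (hstat : IsStationary X μ) (n : ℕ) :
    Tendsto (maxDF X μ n) atTop (𝓝 1) := by
  have h1 : Tendsto (fun u => 1 - n * (1 - marginalDF X μ u)) atTop (𝓝 1) := by
    have : Tendsto (marginalDF X μ) atTop (𝓝 1) := tendsto_cdf_atTop _
    simpa using ((this.const_sub 1).const_mul (n : ℝ)).const_sub 1
  refine tendsto_of_tendsto_of_tendsto_of_le_of_le h1 tendsto_const_nhds (fun u => ?_)
    fun u => maxDF_le_one n u
  have := maxDF_sub_maxDF_add_le hX hstat 0 n u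
  rw [zero_add, maxDF_zero] at this
  change 1 - n * (1 - marginalDF X μ u) ≤ maxDF X μ n u
  linarith

lemma tendsto_maxDF_atBot (hX : ∀ j, Measurable (X j)) (hstat : IsStationary X μ) {n : ℕ}
    (hn : 1 ≤ n) : Tendsto (maxDF X μ n) atBot (𝓝 0) := by
  have h1 : Tendsto (marginalDF X μ) atBot (𝓝 0) := tendsto_cdf_atBot _
  refine squeeze_zero (fun u => maxDF_nonneg n u) (fun u => ?_) h1
  rw [← maxDF_one hX hstat]
  exact antitone_maxDF u hn

lemma tendsto_phantomDF_atBot (hX : ∀ j, Measurable (X j)) (hstat : IsStationary X μ) :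
    Tendsto (phantomDF X μ) atBot (𝓝 0) := by
  have h1 : ∀ᶠ u in atBot, 2 * Real.exp 1 * maxDF X μ 1 u < 1 :=
    ((tendsto_maxDF_atBot hX hstat le_rfl).const_mul _).eventually (gt_mem_nhds (by simp))
  refine tendsto_const_nhds.congr' ?_
  filter_upwards [h1] with u hu
  refine le_antisymm (phantomDF_nonneg u) (ciSup_le fun n => ?_)
  rcases Nat.eq_zero_or_pos n with rfl | hn
  · simp [phantomTerm]
  · refine (phantomTerm_eq_zero (le_trans ?_ hu.le)).le
    have : maxDF X μ n u ≤ maxDF X μ 1 u := antitone_maxDF u hn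
    gcongr

lemma isDistributionFunction_of_continuous {G : ℝ → ℝ} (hG : Continuous G) (hmono : Monotone G)
    (h0 : Tendsto G atBot (𝓝 0)) (h1 : Tendsto G atTop (𝓝 1)) : IsDistributionFunction G := by
  let f : StieltjesFunction ℝ := ⟨G, hmono, fun x => hG.continuousWithinAt⟩
  refine ⟨f.measure, f.isProbabilityMeasure h0 h1, fun x => ?_⟩
  rw [cdf_measure_stieltjesFunction f h0 h1]

variable {θ K : ℝ} {r₀ : ℕ}

lemma continuous_phantomDF (hX : ∀ j, Measurable (X j)) (hstat : IsStationary X μ)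
    (hcont : Continuous (marginalDF X μ)) (hθ : 2 < θ) (hK : 0 < K)
    (hmix : ∀ r : ℕ, r₀ ≤ r → MixesAt X μ r (K * (r : ℝ) ^ (-θ))) :
    Continuous (phantomDF X μ) := by
  have hc : ∀ n, Continuous (maxDF X μ n) := fun n => continuous_probLE hX hstat hcont _
  refine continuous_iff_continuousAt.2 fun u => ?_
  -- Where `F u < 1` the supremum is locally finite. Where `F u = 1` all terms may matter, but each
  -- `maxDF X μ n` tends to `1` at `u`, which drives the supremum to its upper bound `1`.
  rcases (marginalDF_le_one (X := X) (μ := μ) u).lt_or_eq with hu | hu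
  · obtain ⟨N, hN⟩ := exists_maxDF_lt hX hstat hθ hK hmix hu
      (by positivity : 0 < 1 / (2 * Real.exp 1))
    refine continuousAt_phantomDF_of_lt (N := N) hc ?_
    rwa [lt_div_iff₀' (by positivity)] at hN
  · have h1 := maxDF_eq_one hX hstat hu
    rw [ContinuousAt, phantomDF_eq_one h1]
    exact tendsto_phantomDF_one fun n => h1 n ▸ (hc n).tendsto u

lemma exists_forall_abs_maxDF_sub_phantomDF_pow_le (hX : ∀ j, Measurable (X j))
    (hstat : IsStationary X μ) (hθ : 2 < θ) (hK : 0 < K)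
    (hmix : ∀ r : ℕ, r₀ ≤ r → MixesAt X μ r (K * (r : ℝ) ^ (-θ))) {ε : ℝ} (hε : 0 < ε) :
    ∃ m₀ : ℕ, 1 ≤ m₀ ∧ ∀ u, Real.exp (-1) ≤ maxDF X μ m₀ u →
      ∀ n : ℕ, |maxDF X μ n u - phantomDF X μ u ^ n| ≤ ε := by
  have hε' : 0 < min (ε / 19) (1 / 10) := by positivity
  obtain ⟨m₀, hm₀⟩ := exists_forall_abs_maxDF_sub_exp_le hX hstat hθ hK hmix hε'
  refine ⟨max 1 m₀, le_max_left _ _, fun u hu n => ?_⟩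
  rcases (marginalDF_le_one (X := X) (μ := μ) u).lt_or_eq with hu1 | hu1
  · have hex : ∃ n, maxDF X μ n u < Real.exp (-1) :=
      exists_maxDF_lt hX hstat hθ hK hmix hu1 (Real.exp_pos _)
    classical
    -- The crossing time is `m = N - 1`; the assumption at the index `max 1 m₀` ensures that it is
    -- at least `m₀`.
    obtain ⟨N, hN⟩ : ∃ N, N = Nat.find hex := ⟨_, rfl⟩
    have h1 : maxDF X μ N u < Real.exp (-1) := hN ▸ Nat.find_spec hex
    have h2 : max 1 m₀ < N := by
      by_contra! h
      exact absurd (hu.trans (antitone_maxDF u h)) (not_le.2 h1)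
    obtain ⟨m, rfl⟩ : ∃ m, N = m + 1 := ⟨N - 1, by omega⟩
    have h3 : Real.exp (-1) ≤ maxDF X μ m u := not_lt.1 (Nat.find_min hex (by omega))
    have h4 := hm₀ m (by omega) u h3 h1
    have h5 := abs_sub_iSup_phantomTerm_pow_le (by omega) (min_le_right _ _) h3 h4 n
    refine h5.trans ?_
    linarith [min_le_left (ε / 19) (1 / 10)]
  · rw [maxDF_eq_one hX hstat hu1, phantomDF_eq_one (maxDF_eq_one hX hstat hu1)]
    simpa using hε.le

lemma tendsto_maxDF_sub_phantomDF_pow (hX : ∀ j, Measurable (X j)) (hstat : IsStationary X μ)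
    (hcont : Continuous (marginalDF X μ)) (hθ : 2 < θ) (hK : 0 < K)
    (hmix : ∀ r : ℕ, r₀ ≤ r → MixesAt X μ r (K * (r : ℝ) ^ (-θ))) (u : ℕ → ℝ) :
    Tendsto (fun n => maxDF X μ n (u n) - phantomDF X μ (u n) ^ n) atTop (𝓝 0) := by
  rw [Metric.tendsto_atTop]
  intro ε hε
  obtain ⟨m, hm, h⟩ :=
    exists_forall_abs_maxDF_sub_phantomDF_pow_le hX hstat hθ hK hmix (by positivity : 0 < ε / 3)
  -- Below the level `v` at which `maxDF X μ m` equals `1/e` the uniform estimate is unavailable.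
  -- There both terms are dominated by their values at `v`, where `phantomDF X μ v < 1` makes the
  -- powers tend to `0`.
  obtain ⟨v, hv⟩ : ∃ v, maxDF X μ m v = Real.exp (-1) := by
    refine mem_range_of_exists_le_of_exists_ge (continuous_probLE hX hstat hcont _) ?_ ?_
    · exact ((tendsto_maxDF_atBot hX hstat hm).eventually
        (ge_mem_nhds (Real.exp_pos (-1)))).exists
    · exact ((tendsto_maxDF_atTop hX hstat m).eventually
        (le_mem_nhds (by simp : Real.exp (-1) < 1))).exists
  have hv1 : marginalDF X μ v < 1 := by
    refine (marginalDF_le_one v).lt_of_ne fun h1 => ?_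
    rw [maxDF_eq_one hX hstat h1] at hv
    exact absurd hv (by simp : Real.exp (-1) < 1).ne'
  have hG : phantomDF X μ v < 1 := by
    obtain ⟨N, hN⟩ := exists_maxDF_lt hX hstat hθ hK hmix hv1
      (by positivity : 0 < 1 / (2 * Real.exp 1))
    rw [lt_div_iff₀' (by positivity)] at hN
    exact phantomDF_lt_one hN.le
  obtain ⟨N, hN⟩ := exists_pow_lt_of_lt_one (by positivity : 0 < ε / 3) hG
  refine ⟨N, fun n hn => ?_⟩
  rw [Real.dist_0_eq_abs]
  rcases le_or_gt (Real.exp (-1)) (maxDF X μ m (u n)) with hu | hu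
  · exact (h _ hu n).trans_lt (by linarith)
  · have huv : u n ≤ v := by
      by_contra! h1
      exact absurd (monotone_maxDF m h1.le) (by rw [hv]; exact not_le.2 hu)
    have h1 := (abs_le.1 (h v hv.ge n)).2
    have h2 : phantomDF X μ v ^ n < ε / 3 :=
      (pow_le_pow_of_le_one (phantomDF_nonneg v) hG.le hn).trans_lt hN
    have h3 : phantomDF X μ (u n) ^ n ≤ phantomDF X μ v ^ n :=
      pow_le_pow_left₀ (phantomDF_nonneg _) (monotone_phantomDF huv) n
    have h4 : 0 ≤ phantomDF X μ (u n) ^ n := pow_nonneg (phantomDF_nonneg _) n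
    have h5 := monotone_maxDF (X := X) (μ := μ) n huv
    have h6 := maxDF_nonneg (X := X) (μ := μ) n (u n)
    rw [abs_lt]
    constructor <;> linarith

end

end PhantomDF

theorem mainTheorem8 {Ω : Type*} [MeasurableSpace Ω] (μ : Measure Ω) [IsProbabilityMeasure μ]
    (X : ℕ → Ω → ℝ) (hmeas : ∀ j, Measurable (X j))
    (hstat : PhantomDF.IsStationary X μ)
    (hcont : Continuous (PhantomDF.marginalDF X μ))
    (b : ℝ) (hb : 0 < b)
    (hconc : PhantomDF.Concentration (PhantomDF.marginalDF X μ) b)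
    (hdep : PhantomDF.IsEtaWeaklyDependent X μ)
    (β : ℝ) (hβ : 2 * (1 + 1 / b) < β)
    (hrate : ∃ C : ℝ, ∀ᶠ r : ℕ in atTop,
      PhantomDF.etaCoeff X μ r ≤ ENNReal.ofReal (C * (r : ℝ) ^ (-β))) :
    PhantomDF.AdmitsContinuousPhantomDF X μ := by
  obtain ⟨θ, K, r₀, hθ, hK, hmix'⟩ :=
    PhantomDF.exists_abs_probLE_union_sub_le hmeas hstat hb hconc hβ hrate
  have hmix : ∀ r : ℕ, r₀ ≤ r → PhantomDF.MixesAt X μ r (K * (r : ℝ) ^ (-θ)) :=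
    fun r hr u S T hST => (hmix' r hr u S T hST).trans_eq (by ring)
  have hG := PhantomDF.continuous_phantomDF hmeas hstat hcont hθ hK hmix
  refine ⟨PhantomDF.phantomDF X μ, hG, PhantomDF.isDistributionFunction_of_continuous hG
    PhantomDF.monotone_phantomDF (PhantomDF.tendsto_phantomDF_atBot hmeas hstat)
    (PhantomDF.tendsto_phantomDF_one (PhantomDF.tendsto_maxDF_atTop hmeas hstat)), fun u => ?_⟩
  refine (PhantomDF.tendsto_maxDF_sub_phantomDF_pow hmeas hstat hcont hθ hK hmix u).congr' ?_
  filter_upwards [eventually_ge_atTop 1] with n hn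
  rw [PhantomDF.measureReal_partialMax_le hn]
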